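/- Let $r\in\{3,4,\dots,\infty\}$ and let $M$ be a connected, Hausdorff, paracompact $C^{r}$ manifold of dimension $n\ge 2$ (without boundary), endowed with a $C^{r-1}$ Lorentzian metric $g$ of signature $(-,+,\dots,+)$ and a time-orientation, i.e. a choice at each point of one of the two causal cones (the future cone) which locally is the one selected by a $C^{r-1}$ causal vector field; then $(M,g)$ is called a spacetime. A tangent vector $v$ is timelike if $g(v,v)<0$ and causal if $v\neq 0$ and $g(v,v)\le 0$. A future-directed timelike (resp. causal) curve is a piecewise $C^{r}$ curve $\gamma:[a,b]\to M$, $a<b$, all of whose velocity vectors (including both lateral ones at each break) are timelike (resp. causal) and lie in the future cone. Write $p\ll q$ if there is a future-directed timelike curve from $p$ to $q$, and put $I^{+}(p)=\{q: p\ll q\}$, $I^{-}(p)=\{q: q\ll p\}$. The spacetime is past (resp. future) distinguishing if $I^{-}(p)=I^{-}(q)$ (resp. $I^{+}(p)=I^{+}(q)$) implies $p=q$, for all $p,q\in M$. A Borel measure $m$ on $M$ is admissible if $m(M)<\infty$, $m(U)>0$ for every non-empty open $U\subset M$, and the topological boundaries of $I^{+}(p)$ and $I^{-}(p)$ have $m$-measure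 $0$ for every $p\in M$. Its volume functions are $t^{-}(p)=m(I^{-}(p))$ and $t^{+}(p)=-m(I^{+}(p))$. A function $t:M\to\mathbb{R}$, not necessarily continuous, is a generalized time function if $t\circ\gamma$ is strictly increasing on $[a,b]$ for every future-directed causal curve $\gamma:[a,b]\to M$. \textbf{Theorem.} Let $(M,g)$ be a spacetime and let $m$ be any admissible measure on $M$. Then $(M,g)$ is past distinguishing if and only if $t^{-}$ is a generalized time function, and $(M,g)$ is future distinguishing if and only if $t^{+}$ is a generalized time function. -/

import Mathlib

open scoped Manifold ContDiff Topology
open Set MeasureTheory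

noncomputable section

/-- A spacetime of dimension `n` on the `C^r` manifold `M`: a `C^(r-1)` Lorentzian metric `g` of
signature `(-,+,…,+)` with a time-orientation, that is a choice of one of the two causal cones at
every point, which near every point is selected by a `C^(r-1)` causal vector field. Connectedness,
the Hausdorff property and paracompactness of `M` are imposed where spacetimes are used. -/
structure Spacetime (n : ℕ) (r : ℕ∞) (M : Type*) [TopologicalSpace M]
    [ChartedSpace (EuclideanSpace ℝ (Fin n)) M] [IsManifold (𝓡 n) 1 M] where
  /-- The metric tensor. -/
  g (x : M) : TangentSpace (𝓡 n) x →L[ℝ] TangentSpace (𝓡 n) x →L[ℝ] ℝ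
  symm (x : M) (v w : TangentSpace (𝓡 n) x) : g x v w = g x w v
  /-- Every tangent space has an orthonormal basis `e₀, …, e_{n-1}` with `e₀` timelike and the
  other vectors spacelike. -/
  lorentzian (x : M) : ∃ e : Module.Basis (Fin n) ℝ (TangentSpace (𝓡 n) x),
    ∀ i j, g x (e i) (e j) = if i = j then (if (i : ℕ) = 0 then -1 else 1) else 0
  contMDiff : ContMDiff (𝓡 n)
    ((𝓡 n).prod 𝓘(ℝ, EuclideanSpace ℝ (Fin n) →L[ℝ] EuclideanSpace ℝ (Fin n) →L[ℝ] ℝ))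
    ((r - 1 : ℕ∞) : ℕ∞ω)
    (fun x ↦ Bundle.TotalSpace.mk'
      (EuclideanSpace ℝ (Fin n) →L[ℝ] EuclideanSpace ℝ (Fin n) →L[ℝ] ℝ)
      (E := fun y : M ↦ TangentSpace (𝓡 n) y →L[ℝ] TangentSpace (𝓡 n) y →L[ℝ] ℝ) x (g x))
  /-- The future causal cone at each point. -/
  future (x : M) : Set (TangentSpace (𝓡 n) x)
  /-- The future cone is one of the two causal cones: the causal vectors `v` with `g(v,T) < 0`,
  for some timelike vector `T`. -/
  future_isCone (x : M) : ∃ T : TangentSpace (𝓡 n) x, g x T T < 0 ∧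
    future x = {v | v ≠ 0 ∧ g x v v ≤ 0 ∧ g x v T < 0}
  /-- The choice of cones is smooth: locally it is the one selected by a causal vector field
  `X` of class `C^(r-1)`. -/
  future_smooth (x : M) : ∃ U : Set M, IsOpen U ∧ x ∈ U ∧
    ∃ X : (y : M) → TangentSpace (𝓡 n) y,
      ContMDiffOn (𝓡 n) (𝓡 n).tangent ((r - 1 : ℕ∞) : ℕ∞ω)
        (fun y ↦ (⟨y, X y⟩ : TangentBundle (𝓡 n) M)) U ∧
      ∀ y ∈ U, X y ∈ future y

namespace Spacetime

variable {n : ℕ} {r : ℕ∞} {M : Type*} [TopologicalSpace M]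
  [ChartedSpace (EuclideanSpace ℝ (Fin n)) M] [IsManifold (𝓡 n) 1 M]

/-- A future-directed causal tangent vector: a (nonzero) element of the future causal cone. -/
def IsFutureCausal (S : Spacetime n r M) {x : M} (v : TangentSpace (𝓡 n) x) : Prop :=
  v ∈ S.future x

/-- A future-directed timelike tangent vector. -/
def IsFutureTimelike (S : Spacetime n r M) {x : M} (v : TangentSpace (𝓡 n) x) : Prop :=
  v ∈ S.future x ∧ S.g x v v < 0

/-- `γ` restricted to `[a, b]`, with `a < b`, is a piecewise `C^r` curve whose velocity is
everywhere future-directed causal: for a partition `a = t₀ < t₁ < ⋯ < t_N = b`, the curve is `C^r`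
on every closed piece `[tᵢ, tᵢ₊₁]`, and its velocity within the piece is future-directed causal at
every point of the piece (in particular both lateral velocities at every break are). -/
def IsFutureCausalCurve (S : Spacetime n r M) (γ : ℝ → M) (a b : ℝ) : Prop :=
  a < b ∧ ∃ (N : ℕ) (t : ℕ → ℝ), t 0 = a ∧ t N = b ∧ ∀ i < N, t i < t (i + 1) ∧
    ContMDiffOn 𝓘(ℝ, ℝ) (𝓡 n) (r : ℕ∞ω) γ (Icc (t i) (t (i + 1))) ∧
    ∀ s ∈ Icc (t i) (t (i + 1)), S.IsFutureCausal
      (mfderivWithin 𝓘(ℝ, ℝ) (𝓡 n) γ (Icc (t i) (t (i + 1))) s (1 : ℝ))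

/-- The same with a future-directed timelike velocity. -/
def IsFutureTimelikeCurve (S : Spacetime n r M) (γ : ℝ → M) (a b : ℝ) : Prop :=
  a < b ∧ ∃ (N : ℕ) (t : ℕ → ℝ), t 0 = a ∧ t N = b ∧ ∀ i < N, t i < t (i + 1) ∧
    ContMDiffOn 𝓘(ℝ, ℝ) (𝓡 n) (r : ℕ∞ω) γ (Icc (t i) (t (i + 1))) ∧
    ∀ s ∈ Icc (t i) (t (i + 1)), S.IsFutureTimelike
      (mfderivWithin 𝓘(ℝ, ℝ) (𝓡 n) γ (Icc (t i) (t (i + 1))) s (1 : ℝ))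

/-- The chronological relation `p ≪ q`. -/
def Chron (S : Spacetime n r M) (p q : M) : Prop :=
  ∃ (γ : ℝ → M) (a b : ℝ), S.IsFutureTimelikeCurve γ a b ∧ γ a = p ∧ γ b = q

/-- The chronological future `I⁺(p)`. -/
def chronFuture (S : Spacetime n r M) (p : M) : Set M := {q | S.Chron p q}

/-- The chronological past `I⁻(p)`. -/
def chronPast (S : Spacetime n r M) (p : M) : Set M := {q | S.Chron q p}

/-- Future distinguishing: distinct events have distinct chronological futures. -/
def FutureDistinguishing (S : Spacetime n r M) : Prop :=
  ∀ p q : M, S.chronFuture p = S.chronFuture q → p = q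

/-- Past distinguishing: distinct events have distinct chronological pasts. -/
def PastDistinguishing (S : Spacetime n r M) : Prop :=
  ∀ p q : M, S.chronPast p = S.chronPast q → p = q

/-- A (not necessarily continuous) generalized time function: strictly increasing on every
future-directed causal curve. -/
def IsGeneralizedTimeFunction (S : Spacetime n r M) (τ : M → ℝ) : Prop :=
  ∀ (γ : ℝ → M) (a b : ℝ), S.IsFutureCausalCurve γ a b → StrictMonoOn (fun s ↦ τ (γ s)) (Icc a b)

/-- An admissible measure: finite, positive on nonempty open sets, and zero on the topological
boundaries of all the sets `I⁺(p)` and `I⁻(p)`. -/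
structure IsAdmissible [MeasurableSpace M] (S : Spacetime n r M) (m : Measure M) : Prop where
  finite : m univ < ⊤
  pos_of_isOpen : ∀ U : Set M, IsOpen U → U.Nonempty → 0 < m U
  frontier_chronFuture : ∀ p : M, m (frontier (S.chronFuture p)) = 0
  frontier_chronPast : ∀ p : M, m (frontier (S.chronPast p)) = 0

/-- The volume function `t⁻(p) = m(I⁻(p))`. -/
def tMinus [MeasurableSpace M] (S : Spacetime n r M) (m : Measure M) (p : M) : ℝ :=
  (m (S.chronPast p)).toReal

/-- The volume function `t⁺(p) = -m(I⁺(p))`. -/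
def tPlus [MeasurableSpace M] (S : Spacetime n r M) (m : Measure M) (p : M) : ℝ :=
  -(m (S.chronFuture p)).toReal

end Spacetime

end

/-! Suppose the past is distinguished and let γ be a future causal curve. Push-up
(`Chron.trans_causal`) makes the sets I⁻(γ s) increase with s. If two of them agreed, all those in
between would agree too, so γ would be constant there and have zero velocity, which a causal curve
excludes. Hence for u < v some z lies in I⁻(γ v) but not in I⁻(γ u). The set I⁺(z) ∩ I⁻(γ v) is
open, nonempty and disjoint from I⁻(γ u), so it has positive measure and t⁻ strictly increases.

Conversely, let I⁻(p) = I⁻(q) with p ≠ q, and take a compact neighbourhood K of p without q. Points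
x of I⁻(p) accumulate at p, and each is joined to q by a timelike curve, which leaves the interior
of K at some f x ≪ q. A limit y of the points f x differs from p and is reached from p by a causal
geodesic. Any w ≪ y satisfies w ≪ f x ≪ q for suitable x, so I⁻(y) ⊆ I⁻(q) = I⁻(p), and t⁻ fails to
increase strictly from p to y. The future half follows by reversing the time-orientation.

The local facts used are those of normal neighbourhoods, collected in `IsLocalChronology`: timelike
geodesics reach an open set, curves starting inside the timelike cone of a point remain in it, and
limits of timelike geodesics are causal. They come from the geodesic flow in momentum form, with
Hamiltonian ½ ξ(A ξ), where A is the inverse metric. For r = 3 the metric is only C² and the field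
only C¹. No differentiability of the flow away from zero momentum is needed: at (q, 0) the
linearized field has square zero, which gives the strict derivative of the exponential map by hand
(`hasStrictFDerivAt_flow_of_sq_zero`) and an inverse to it. Elsewhere Lipschitz dependence suffices,
because the Gauss lemma is proved for finite differences with a quadratic error (`gauss_estimate`).
It yields the derivative of the squared length of the initial momentum with respect to the endpoint,
hence its monotonicity along causal curves (`timelike_of_causal_curve`). -/

/-! ### Autonomous differential equations near an equilibrium. -/

/-- A solution of an autonomous ODE which starts at an equilibrium stays there. -/
theorem eq_of_hasDerivWithinAt_of_equilibrium {V : Type*} [NormedAddCommGroup V] [NormedSpace ℝ V]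
    {X : V → V} {z : V} {K : NNReal} {W : Set V} (hW : W ∈ 𝓝 z) (hX : LipschitzOnWith K X W)
    (hz : X z = 0) {f : ℝ → V} {ε : ℝ} (h0 : f 0 = z)
    (hf : ∀ t ∈ Icc 0 ε, HasDerivWithinAt f (X (f t)) (Icc 0 ε) t) :
    ∀ t ∈ Icc 0 ε, f t = z := by
  have hcont : ContinuousOn f (Icc 0 ε) := fun t ht => (hf t ht).continuousWithinAt
  have hcl : IsClosed ({t | f t = z} ∩ Icc 0 ε) := by
    have := hcont.preimage_isClosed_of_isClosed isClosed_Icc (isClosed_singleton (x := z))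
    rwa [inter_comm] at this
  refine hcl.Icc_subset_of_forall_mem_nhdsWithin h0 ?_
  rintro t ⟨ht, ht0, htε⟩
  -- The field is Lipschitz only on `W`, so uniqueness is applied on a short interval to the right
  -- of `t`, where `f` has not yet left `W`; the set where `f = z` is closed and thus propagates to
  -- all of the interval.
  have hmem : ∀ᶠ s in 𝓝[≥] t, f s ∈ W := by
    have h1 := hcont t ⟨ht0, htε.le⟩
    have h2 : Icc 0 ε ∈ 𝓝[≥] t :=
      Filter.mem_of_superset (Icc_mem_nhdsGE htε) (Icc_subset_Icc_left ht0)
    have h3 : ContinuousWithinAt f (Ici t) t := h1.mono_of_mem_nhdsWithin h2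
    exact h3 (by rw [mem_ofPred_eq.mp ht]; exact hW)
  obtain ⟨b, hb, hbW⟩ := (mem_nhdsGE_iff_exists_Icc_subset).1 hmem
  have htb : t < b := hb
  set c := min b ε with hc
  have htc : t < c := lt_min htb htε
  have hsub : Icc t c ⊆ Icc 0 ε := Icc_subset_Icc ht0 (min_le_right _ _)
  have := ODE_solution_unique_of_mem_Icc_right (v := fun _ => X) (s := fun _ => W) (K := K)
    (f := f) (g := fun _ => z) (a := t) (b := c)
    (fun _ _ => hX) (hcont.mono hsub)
    (fun s hs => (hf s (hsub (Ico_subset_Icc_self hs))).mono_of_mem_nhdsWithin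
      (Filter.mem_of_superset (Icc_mem_nhdsGE (hs.2.trans_le (min_le_right _ _)))
        (Icc_subset_Icc_left (ht0.trans hs.1))))
    (fun s hs => hbW ⟨hs.1, (hs.2.trans_le (min_le_left _ _)).le⟩)
    continuousOn_const
    (fun s hs => by rw [hz]; exact hasDerivWithinAt_const _ _ _)
    (fun s hs => mem_of_mem_nhds hW) ht
  filter_upwards [Icc_mem_nhdsGT htc] with s hs using this hs

/-- The local flow near an equilibrium of a `C¹` vector field, up to a uniform positive time, stays
in a prescribed neighbourhood and is Lipschitz in the initial condition. -/
theorem exists_flow_of_equilibrium {V : Type*} [NormedAddCommGroup V] [NormedSpace ℝ V]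
    [CompleteSpace V] {X : V → V} {z₀ : V} (hX : ContDiffAt ℝ 1 X z₀) (hz : X z₀ = 0)
    {W : Set V} (hW : W ∈ 𝓝 z₀) {K : NNReal} (hK : LipschitzOnWith K X W) :
    ∃ ε > 0, ∃ U ∈ 𝓝 z₀, ∃ α : V → ℝ → V, ∃ L : NNReal,
      (∀ z ∈ U, α z 0 = z ∧ ∀ t ∈ Icc 0 ε,
        HasDerivWithinAt (α z) (X (α z t)) (Icc 0 ε) t ∧ α z t ∈ W) ∧
      ∀ t ∈ Icc 0 ε, LipschitzOnWith L (α · t) U := by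
  obtain ⟨ε, hε, a, r, L, K', hr, hPL⟩ := IsPicardLindelof.of_contDiffAt_one hX
  obtain ⟨α, hα, L', hL⟩ :=
    (hPL 0).exists_forall_mem_closedBall_eq_hasDerivWithinAt_lipschitzOnWith
  have hsub : Icc 0 ε ⊆ Icc (0 - ε) (0 + ε) := by
    intro t ht; constructor <;> linarith [ht.1, ht.2]
  have hconst : ∀ t ∈ Icc 0 ε, α z₀ t = z₀ :=
    eq_of_hasDerivWithinAt_of_equilibrium hW hK hz (hα z₀ (Metric.mem_closedBall_self r.2)).1
      fun t ht => ((hα z₀ (Metric.mem_closedBall_self r.2)).2 t (hsub ht)).mono hsub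
  obtain ⟨ρ, hρ, hρW⟩ := Metric.mem_nhds_iff.1 hW
  have hL1 : (0 : ℝ) < L' + 1 := by positivity
  -- The trajectory of `z₀` is constant, so the Lipschitz bound keeps every trajectory starting
  -- within ρ / (L' + 1) inside the ball of radius ρ; the 1 guards against L' = 0.
  refine ⟨ε, hε, Metric.closedBall z₀ r ∩ Metric.ball z₀ (ρ / (L' + 1)), Filter.inter_mem
    (Metric.closedBall_mem_nhds _ (by exact_mod_cast hr)) (Metric.ball_mem_nhds _ (by positivity)),
    α, L', fun z hz => ⟨(hα z hz.1).1, fun t ht =>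
      ⟨((hα z hz.1).2 t (hsub ht)).mono hsub, hρW ?_⟩⟩,
    fun t ht => (hL t (hsub ht)).mono inter_subset_left⟩
  have h1 := (hL t (hsub ht)).dist_le_mul z hz.1 z₀ (Metric.mem_closedBall_self r.2)
  simp only [hconst t ht] at h1
  rw [Metric.mem_ball]
  have h2 : dist z z₀ < ρ / (L' + 1) := hz.2
  rw [lt_div_iff₀ hL1] at h2
  nlinarith [dist_nonneg (x := z) (y := z₀)]

/-- The time-`ε` map of a flow has at an equilibrium the derivative `exp (ε M) = 1 + ε M`, if the
derivative `M` of the vector field there has square zero. -/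
theorem hasStrictFDerivAt_flow_of_sq_zero {V : Type*} [NormedAddCommGroup V] [NormedSpace ℝ V]
    {X : V → V} {z₀ : V} {M : V →L[ℝ] V} (hX : HasStrictFDerivAt X M z₀) (hM : M ∘L M = 0)
    {ε : ℝ} (hε : 0 < ε) {U : Set V} (hU : U ∈ 𝓝 z₀) {α : V → ℝ → V} {L : NNReal}
    (h0 : ∀ z ∈ U, α z 0 = z)
    (hα : ∀ z ∈ U, ∀ t ∈ Icc 0 ε, HasDerivWithinAt (α z) (X (α z t)) (Icc 0 ε) t)
    (hL : ∀ t ∈ Icc 0 ε, LipschitzOnWith L (α · t) U) (hz : ∀ t ∈ Icc 0 ε, α z₀ t = z₀) :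
    HasStrictFDerivAt (fun z => α z ε) (ContinuousLinearMap.id ℝ V + ε • M) z₀ := by
  refine .of_isLittleO ?_
  rw [Asymptotics.isLittleO_iff]
  intro c hc
  set D : ℝ := ε * ((1 + ε * ‖M‖) * L) + 1 with hD
  have hDpos : 0 < D := by positivity
  set κ : ℝ := c / D with hκ
  have hκpos : 0 < κ := by positivity
  have h1 := (Asymptotics.isLittleO_iff.1 hX.isLittleO) hκpos
  rw [nhds_prod_eq, Filter.eventually_prod_self_iff'] at h1
  obtain ⟨N, hN, hNX⟩ := h1
  obtain ⟨ρ, hρ, hρN⟩ := Metric.mem_nhds_iff.1 hN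
  have hL1 : (0 : ℝ) < L + 1 := by positivity
  set B := U ∩ Metric.ball z₀ (ρ / (L + 1)) with hB
  have hBn : B ∈ 𝓝 z₀ := Filter.inter_mem hU (Metric.ball_mem_nhds _ (by positivity))
  have hstay : ∀ z ∈ B, ∀ t ∈ Icc 0 ε, α z t ∈ N := by
    intro z hzB t ht
    apply hρN
    have h1 := (hL t ht).dist_le_mul z hzB.1 z₀ (mem_of_mem_nhds hU)
    simp only [hz t ht] at h1
    rw [Metric.mem_ball]
    have h2 : dist z z₀ < ρ / (L + 1) := hzB.2
    rw [lt_div_iff₀ hL1] at h2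
    nlinarith [dist_nonneg (x := z) (y := z₀)]
  rw [nhds_prod_eq]
  refine Filter.eventually_prod_self_iff'.2 ⟨B, hBn, fun z hzB w hwB => ?_⟩
  set δ : ℝ → V := fun t => α z t - α w t with hδ
  set d : V := z - w with hd
  have hδ0 : δ 0 = d := by simp [hδ, hd, h0 z hzB.1, h0 w hwB.1]
  have hderiv : ∀ t ∈ Icc 0 ε,
      HasDerivWithinAt δ (X (α z t) - X (α w t)) (Icc 0 ε) t := fun t ht =>
    (hα z hzB.1 t ht).sub (hα w hwB.1 t ht)
  have hLip : ∀ t ∈ Icc 0 ε, ‖δ t‖ ≤ L * ‖d‖ := fun t ht =>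
    (hL t ht).norm_sub_le hzB.1 hwB.1
  have hsmall : ∀ t ∈ Icc 0 ε, ‖X (α z t) - X (α w t) - M (δ t)‖ ≤ κ * (L * ‖d‖) := by
    intro t ht
    refine (hNX _ (hstay z hzB t ht) _ (hstay w hwB t ht)).trans ?_
    exact mul_le_mul_of_nonneg_left (hLip t ht) hκpos.le
  -- Since δ' is nearly M δ and M² = 0, the derivative of M δ is small and M δ stays close to M d.
  -- Integrating δ' ≈ M d then gives δ ε ≈ d + ε M d.
  have hMδ : ∀ t ∈ Icc 0 ε, ‖M (δ t) - M d‖ ≤ ‖M‖ * (κ * (L * ‖d‖)) * ε := by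
    intro t ht
    have h := norm_image_sub_le_of_norm_deriv_le_segment' (f := fun t => M (δ t)) (a := 0) (b := ε)
      (f' := fun t => M (X (α z t) - X (α w t))) (C := ‖M‖ * (κ * (L * ‖d‖)))
      (fun s hs => M.hasFDerivAt.comp_hasDerivWithinAt s (hderiv s hs)) (fun s hs => by
        have e : M (X (α z s) - X (α w s)) = M (X (α z s) - X (α w s) - M (δ s)) := by
          have : M (M (δ s)) = 0 := by
            simpa using congrArg (fun F : V →L[ℝ] V => F (δ s)) hM
          rw [map_sub M (X (α z s) - X (α w s)), this, sub_zero]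
        rw [e]
        exact (M.le_opNorm _).trans
          (mul_le_mul_of_nonneg_left (hsmall s (Ico_subset_Icc_self hs)) (norm_nonneg _))) t ht
    rw [hδ0, sub_zero] at h
    refine h.trans (mul_le_mul_of_nonneg_left ht.2 (by positivity))
  have hfin := norm_image_sub_le_of_norm_deriv_le_segment' (f := fun t => δ t - t • M d)
    (a := 0) (b := ε) (f' := fun t => X (α z t) - X (α w t) - M d)
    (C := κ * (L * ‖d‖) + ‖M‖ * (κ * (L * ‖d‖)) * ε)
    (fun s hs => (hderiv s hs).sub (by
      simpa using (hasDerivWithinAt_id s (Icc 0 ε)).smul_const (M d)))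
    (fun s hs => by
      have hs' := Ico_subset_Icc_self hs
      calc _ = ‖(X (α z s) - X (α w s) - M (δ s)) + (M (δ s) - M d)‖ := by congr 1; abel
        _ ≤ _ := (norm_add_le _ _).trans (add_le_add (hsmall s hs') (hMδ s hs')))
    ε (right_mem_Icc.2 hε.le)
  simp only [hδ0, zero_smul, sub_zero] at hfin
  have e : α z ε - α w ε - (ContinuousLinearMap.id ℝ V + ε • M) (z - w) = δ ε - ε • M d - d := by
    simp [hδ, hd]; abel
  rw [e]
  refine hfin.trans ?_
  have : (κ * (L * ‖d‖) + ‖M‖ * (κ * (L * ‖d‖)) * ε) * ε = κ * (D - 1) * ‖d‖ := by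
    rw [hD]; ring
  rw [this]
  have : κ * D = c := by rw [hκ]; field_simp
  nlinarith [mul_nonneg hκpos.le (norm_nonneg d)]

/-! ### Linear algebra of Lorentzian forms. -/

section LorentzForm

variable {E : Type*} [NormedAddCommGroup E] [NormedSpace ℝ E] {B : E →L[ℝ] E →L[ℝ] ℝ} {T u v : E}

/-- The combination B(v,T) u - B(u,T) v is orthogonal to T, so its square is nonnegative. In the
expansion the two square terms are negative and nonpositive, so the cross term -2 B(u,T) B(v,T)
B(u,v) must be positive. -/
theorem lorentz_neg_of_future (hs : ∀ v w, B v w = B w v) (hT : ∀ u, B u T = 0 → 0 ≤ B u u)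
    (hu : B u u < 0) (hv : B v v ≤ 0) (huT : B u T < 0) (hvT : B v T < 0) : B u v < 0 := by
  have h := hT (B v T • u - B u T • v) (by simp; ring)
  simp only [map_sub, map_smul, sub_apply, smul_apply,
    smul_eq_mul, hs v u] at h
  by_contra hc
  push Not at hc
  have h1 : 0 < B u T * B v T := mul_pos_of_neg_of_neg huT hvT
  nlinarith [mul_nonneg h1.le hc, mul_pos_of_neg_of_neg hvT hvT, mul_pos_of_neg_of_neg huT huT,
    mul_pos (mul_pos_of_neg_of_neg hvT hvT) (neg_pos.2 hu),
    mul_nonneg (mul_pos_of_neg_of_neg huT huT).le (neg_nonneg.2 hv)]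

theorem lorentz_ne_zero_of_causal (hT : ∀ u, u ≠ 0 → B u T = 0 → 0 < B u u) (hv : v ≠ 0)
    (hvv : B v v ≤ 0) : B v T ≠ 0 := fun h => absurd (hT v hv h) (not_lt.2 hvv)

/-- Two timelike vectors on the same side of a causal vector select the same causal cone. -/
theorem lorentz_cone_eq {S X : E} (hs : ∀ v w, B v w = B w v)
    (hS : ∀ u, u ≠ 0 → B u S = 0 → 0 < B u u) (hTT : B T T < 0) (hXX : B X X ≤ 0)
    (hXS : B X S < 0) (hXT : B X T < 0) (hv : v ≠ 0) (hvv : B v v ≤ 0) :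
    B v S < 0 ↔ B v T < 0 := by
  have hS' : ∀ u, B u S = 0 → 0 ≤ B u u := fun u hu => by
    by_cases h : u = 0
    · simp [h]
    · exact (hS u h hu).le
  have hT0 : T ≠ 0 := by rintro rfl; simp at hTT
  have hTS : B T S < 0 := by
    rcases (lorentz_ne_zero_of_causal hS hT0 hTT.le).lt_or_gt with h | h
    · exact h
    -- Otherwise -T and X would both lie on the future side of S, giving B(T,X) > 0.
    · have := lorentz_neg_of_future (u := -T) (v := X) hs hS' (by simpa using hTT) hXX
        (by simpa using h) hXS
      rw [map_neg, neg_apply, hs T X] at this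
      linarith
  constructor
  · intro h
    rw [hs]
    exact lorentz_neg_of_future hs hS' hTT hvv hTS h
  · intro h
    rcases (lorentz_ne_zero_of_causal hS hv hvv).lt_or_gt with h' | h'
    · exact h'
    · have := lorentz_neg_of_future (u := T) (v := -v) hs hS' hTT (by simpa using hvv) hTS
        (by simpa using h')
      rw [map_neg, hs T v] at this
      linarith

end LorentzForm

/-! ### Hamiltonian geodesic flow in a coordinate domain. -/

/-- The metric coefficients `G` of a time-oriented Lorentzian metric on an open subset `Ω` of a
vector space, the future being the side of a constant timelike vector `T`. -/
structure IsLorentzChart {E : Type*} [NormedAddCommGroup E] [NormedSpace ℝ E] (Ω : Set E)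
    (G : E → E →L[ℝ] E →L[ℝ] ℝ) (T : E) : Prop where
  isOpen : IsOpen Ω
  contDiffOn : ContDiffOn ℝ 2 G Ω
  symm : ∀ x ∈ Ω, ∀ v w, G x v w = G x w v
  timelike : ∀ x ∈ Ω, G x T T < 0
  spacelike : ∀ x ∈ Ω, ∀ u, u ≠ 0 → G x u T = 0 → 0 < G x u u

/-- The inverse metric, as a map from covectors to vectors. -/
noncomputable def cometric {E : Type*} [NormedAddCommGroup E] [NormedSpace ℝ E]
    (G : E → E →L[ℝ] E →L[ℝ] ℝ) (x : E) : (E →L[ℝ] ℝ) →L[ℝ] E :=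
  ContinuousLinearMap.inverse (G x)

/-- The Hamiltonian vector field of the geodesic flow on position-momentum pairs. -/
noncomputable def geodesicField {E : Type*} [NormedAddCommGroup E] [NormedSpace ℝ E]
    (G : E → E →L[ℝ] E →L[ℝ] ℝ) (z : E × (E →L[ℝ] ℝ)) : E × (E →L[ℝ] ℝ) :=
  (cometric G z.1 z.2,
    -(1 / 2 : ℝ) • (z.2 ∘L (fderiv ℝ (cometric G) z.1).flip z.2))

/-- `z` is a geodesic in `Ω`, with its momentum, over the time interval `[0, ε]`. -/
def IsGeodesic {E : Type*} [NormedAddCommGroup E] [NormedSpace ℝ E] (Ω : Set E)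
    (G : E → E →L[ℝ] E →L[ℝ] ℝ) (ε : ℝ) (z : ℝ → E × (E →L[ℝ] ℝ)) : Prop :=
  ∀ t ∈ Icc 0 ε, HasDerivWithinAt z (geodesicField G (z t)) (Icc 0 ε) t ∧ (z t).1 ∈ Ω

/-- The squared length of a covector. -/
noncomputable def cometricSq {E : Type*} [NormedAddCommGroup E] [NormedSpace ℝ E]
    (G : E → E →L[ℝ] E →L[ℝ] ℝ) (z : E × (E →L[ℝ] ℝ)) : ℝ :=
  z.2 (cometric G z.1 z.2)

section Geodesics

set_option maxSynthPendingDepth 3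

variable {E : Type*} [NormedAddCommGroup E] [NormedSpace ℝ E]
  {Ω : Set E} {G : E → E →L[ℝ] E →L[ℝ] ℝ} {T : E}

theorem geodesicField_zero (q : E) : geodesicField G (q, 0) = 0 := by
  simp [geodesicField]

namespace IsLorentzChart

variable [FiniteDimensional ℝ E]

/-- A vector in the kernel is orthogonal to `T`, so it would be spacelike if nonzero, while its
square is 0; injectivity suffices in finite dimension. -/
theorem isInvertible (h : IsLorentzChart Ω G T) {x : E} (hx : x ∈ Ω) : (G x).IsInvertible := by
  have hinj : Function.Injective (G x) := by
    refine (injective_iff_map_eq_zero _).2 fun u hu => ?_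
    by_contra hne
    have := h.spacelike x hx u hne (by simp [hu])
    simp [hu] at this
  have hdim : Module.finrank ℝ E = Module.finrank ℝ (E →L[ℝ] ℝ) := by
    rw [← (LinearMap.toContinuousLinearMap (𝕜 := ℝ) (E := E) (F' := ℝ)).finrank_eq]
    exact (Subspace.dual_finrank_eq (K := ℝ) (V := E)).symm
  refine ⟨(LinearMap.linearEquivOfInjective (G x).toLinearMap hinj
    hdim).toContinuousLinearEquiv, ?_⟩
  ext; simp

theorem cometric_metric (h : IsLorentzChart Ω G T) {x : E} (hx : x ∈ Ω) (v : E) :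
    cometric G x (G x v) = v := by
  obtain ⟨e, he⟩ := h.isInvertible hx
  simp [cometric, ← he]

theorem metric_cometric (h : IsLorentzChart Ω G T) {x : E} (hx : x ∈ Ω) (ξ : E →L[ℝ] ℝ) :
    G x (cometric G x ξ) = ξ := by
  obtain ⟨e, he⟩ := h.isInvertible hx
  simp [cometric, ← he]

theorem cometric_symm (h : IsLorentzChart Ω G T) {x : E} (hx : x ∈ Ω) (ξ η : E →L[ℝ] ℝ) :
    ξ (cometric G x η) = η (cometric G x ξ) := by
  conv_lhs => rw [← h.metric_cometric hx ξ, h.symm x hx, h.metric_cometric hx η]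

theorem contDiffAt_cometric (h : IsLorentzChart Ω G T) {n : ℕ∞ω} {x : E} (hx : x ∈ Ω)
    (hG : ContDiffOn ℝ n G Ω) : ContDiffAt ℝ n (cometric G) x := by
  obtain ⟨e, he⟩ := h.isInvertible hx
  have h1 : ContDiffAt ℝ n ContinuousLinearMap.inverse (G x) := by
    rw [← he]; exact contDiffAt_map_inverse e
  exact h1.comp x (hG.contDiffAt (h.isOpen.mem_nhds hx))

theorem contDiffOn_geodesicField (h : IsLorentzChart Ω G T) {n : ℕ∞ω}
    (hG : ContDiffOn ℝ (n + 1) G Ω) :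
    ContDiffOn ℝ n (geodesicField G) (Ω ×ˢ univ) := by
  have hA : ContDiffOn ℝ (n + 1) (cometric G) Ω := fun x hx =>
    (h.contDiffAt_cometric hx hG).contDiffWithinAt
  have hA' : ContDiffOn ℝ n (cometric G) Ω := hA.of_le le_self_add
  have hD : ContDiffOn ℝ n (fderiv ℝ (cometric G)) Ω :=
    hA.fderiv_of_isOpen h.isOpen le_rfl
  have h1 : ContDiffOn ℝ n (fun z : E × (E →L[ℝ] ℝ) => cometric G z.1) (Ω ×ˢ univ) :=
    hA'.comp contDiffOn_fst fun z hz => hz.1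
  have h2 : ContDiffOn ℝ n (fun z : E × (E →L[ℝ] ℝ) => (fderiv ℝ (cometric G) z.1).flip)
      (Ω ×ˢ univ) :=
    (ContinuousLinearMap.flipₗᵢ ℝ E (E →L[ℝ] ℝ) E).toContinuousLinearEquiv.contDiff.comp_contDiffOn
      (hD.comp contDiffOn_fst fun z hz => hz.1)
  exact (h1.clm_apply contDiffOn_snd).prodMk
    ((contDiff_const_smul (-(1 / 2 : ℝ))).comp_contDiffOn
      (contDiffOn_snd.clm_comp (h2.clm_apply contDiffOn_snd)))

/-- The first component of the field is linear in the momentum and the second quadratic, so at zero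
momentum only the linear part survives. It sends (v, ξ) to (A ξ, 0), whose square is zero, as
`hasStrictFDerivAt_flow_of_sq_zero` requires. -/
theorem hasStrictFDerivAt_geodesicField (h : IsLorentzChart Ω G T) {q : E} (hq : q ∈ Ω) :
    HasStrictFDerivAt (geodesicField G)
      ((cometric G q ∘L ContinuousLinearMap.snd ℝ E (E →L[ℝ] ℝ)).prod 0) (q, 0) := by
  have hA : ContDiffAt ℝ 2 (cometric G) q := h.contDiffAt_cometric hq h.contDiffOn
  have hD : ContDiffAt ℝ 1 (fderiv ℝ (cometric G)) q := hA.fderiv_right (by norm_num)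
  have h1 : HasStrictFDerivAt (fun z : E × (E →L[ℝ] ℝ) => cometric G z.1) _ (q, 0) :=
    HasStrictFDerivAt.comp (g := cometric G) (q, 0)
      (hA.hasStrictFDerivAt two_ne_zero) hasStrictFDerivAt_fst
  have h2 : HasStrictFDerivAt (fun z : E × (E →L[ℝ] ℝ) => fderiv ℝ (cometric G) z.1) _ (q, 0) :=
    HasStrictFDerivAt.comp (g := fderiv ℝ (cometric G)) (q, 0)
      (hD.hasStrictFDerivAt one_ne_zero) hasStrictFDerivAt_fst
  have h3 : HasStrictFDerivAt
      (fun z : E × (E →L[ℝ] ℝ) => (fderiv ℝ (cometric G) z.1).flip) _ (q, 0) :=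
    HasStrictFDerivAt.comp (q, 0) (ContinuousLinearMap.flipₗᵢ ℝ E
      (E →L[ℝ] ℝ) E).toContinuousLinearEquiv.hasStrictFDerivAt h2
  have h4 := (h1.clm_apply (hasStrictFDerivAt_snd (p := (q, 0)))).prodMk
    ((hasStrictFDerivAt_snd.clm_comp (h3.clm_apply hasStrictFDerivAt_snd)).const_smul
      (-(1 / 2 : ℝ)))
  refine h4.congr_fderiv ?_
  ext <;> simp

end IsLorentzChart

namespace IsGeodesic

variable {ε : ℝ} {z w : ℝ → E × (E →L[ℝ] ℝ)}

theorem hasDerivWithinAt_fst (hz : IsGeodesic Ω G ε z) {t : ℝ} (ht : t ∈ Icc 0 ε) :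
    HasDerivWithinAt (fun t => (z t).1) (cometric G (z t).1 (z t).2) (Icc 0 ε) t :=
  (hz t ht).1.fst

theorem hasDerivWithinAt_snd (hz : IsGeodesic Ω G ε z) {t : ℝ} (ht : t ∈ Icc 0 ε) :
    HasDerivWithinAt (fun t => (z t).2)
      (-(1 / 2 : ℝ) • ((z t).2 ∘L (fderiv ℝ (cometric G) (z t).1).flip (z t).2)) (Icc 0 ε) t :=
  (hz t ht).1.snd

variable [FiniteDimensional ℝ E]

/-- Conservation of energy. -/
theorem cometricSq_eq (h : IsLorentzChart Ω G T) (hz : IsGeodesic Ω G ε z) {t : ℝ}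
    (ht : t ∈ Icc 0 ε) : cometricSq G (z t) = cometricSq G (z 0) := by
  have hd : ∀ s ∈ Icc 0 ε, HasDerivWithinAt (fun t => cometricSq G (z t)) 0 (Icc 0 ε) s := by
    intro s hs
    have hA := ((h.contDiffAt_cometric (hz s hs).2 h.contDiffOn).differentiableAt
      two_ne_zero).hasFDerivAt
    have h1 := hA.comp_hasDerivWithinAt s (hz.hasDerivWithinAt_fst hs)
    have h2 := hz.hasDerivWithinAt_snd hs
    refine (h2.clm_apply (h1.clm_apply h2)).congr_deriv ?_
    simp only [one_div, smul_apply, ContinuousLinearMap.comp_apply,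
      ContinuousLinearMap.flip_apply, smul_eq_mul, Function.comp_apply, map_add,
      h.cometric_symm (hz s hs).2 (z s).2 _]
    ring
  have := norm_image_sub_le_of_norm_deriv_le_segment' hd (C := 0) (by simp) t ht
  rw [zero_mul, norm_le_zero_iff, sub_eq_zero] at this
  exact this

/-- A geodesic with causal momentum cannot change its time-orientation: at a sign change the
momentum would annihilate `T`, but by conservation of energy it is causal, and it is nonzero. -/
theorem apply_neg (h : IsLorentzChart Ω G T) (hz : IsGeodesic Ω G ε z)
    (h0 : cometricSq G (z 0) ≤ 0) (hT : (z 0).2 T < 0) (hne : ∀ t ∈ Icc 0 ε, (z t).2 ≠ 0)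
    {t : ℝ} (ht : t ∈ Icc 0 ε) : (z t).2 T < 0 := by
  by_contra hc
  push Not at hc
  have hcont : ContinuousOn (fun t => (z t).2 T) (Icc 0 t) := fun s hs =>
    (((hz.hasDerivWithinAt_snd ⟨hs.1, hs.2.trans ht.2⟩).continuousWithinAt).clm_apply
      continuousWithinAt_const).mono (Icc_subset_Icc_right ht.2)
  obtain ⟨s, hs, hs0⟩ := intermediate_value_Icc ht.1 hcont ⟨hT.le, hc⟩
  have hs' : s ∈ Icc 0 ε := ⟨hs.1, hs.2.trans ht.2⟩
  have hΩ := (hz s hs').2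
  have e := h.metric_cometric hΩ (z s).2
  refine lorentz_ne_zero_of_causal (B := G (z s).1) (T := T)
    (v := cometric G (z s).1 (z s).2) (h.spacelike _ hΩ) ?_ ?_ ?_
  · intro h0'
    rw [h0', map_zero] at e
    exact hne s hs' e.symm
  · rw [e]
    exact (hz.cometricSq_eq h hs').trans_le h0
  · rw [e]; exact hs0

/-- The position along a geodesic gains two derivatives over the geodesic field. -/
theorem contDiffOn_fst (h : IsLorentzChart Ω G T) (hz : IsGeodesic Ω G ε z) (hε : 0 < ε)
    {n : ℕ∞} (hG : ContDiffOn ℝ (n + 1) G Ω) :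
    ContDiffOn ℝ (n + 1 + 1) (fun t => (z t).1) (Icc 0 ε) := by
  have hn : ((n : ℕ∞ω) + 1 = ω) → False := by
    have : (n : ℕ∞ω) + 1 = ((n + 1 : ℕ∞) : ℕ∞ω) := rfl
    rw [this]; exact WithTop.coe_ne_top
  have hn' : (n : ℕ∞ω) = ω → False := WithTop.coe_ne_top
  have hu : UniqueDiffOn ℝ (Icc 0 ε) := uniqueDiffOn_Icc hε
  have hF := h.contDiffOn_geodesicField hG
  have hmaps : MapsTo z (Icc 0 ε) (Ω ×ˢ univ) := fun t ht => ⟨(hz t ht).2, mem_univ _⟩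
  -- Bootstrap: a solution of a Cⁿ equation is Cⁿ, then Cⁿ⁺¹ because its derivative is the field
  -- along it. The position gains once more because its derivative only involves the cometric, which
  -- is Cⁿ⁺¹.
  have hz0 : ContDiffOn ℝ n z (Icc 0 ε) :=
    ODE.contDiffOn_enat_Icc_of_hasDerivWithinAt (f := fun _ => geodesicField G) (u := Ω ×ˢ univ)
      (hF.comp contDiffOn_snd fun y hy => hy.2) (fun t ht => (hz t ht).1) hmaps
  have hz1 : ContDiffOn ℝ (n + 1) z (Icc 0 ε) := by
    rw [contDiffOn_succ_iff_derivWithin hu]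
    refine ⟨fun t ht => (hz t ht).1.differentiableWithinAt, fun h => (hn' h).elim, ?_⟩
    exact (hF.comp hz0 hmaps).congr fun t ht => (hz t ht).1.derivWithin (hu t ht)
  rw [contDiffOn_succ_iff_derivWithin hu]
  refine ⟨fun t ht => (hz.hasDerivWithinAt_fst ht).differentiableWithinAt,
    fun h => (hn h).elim, ?_⟩
  have hA : ContDiffOn ℝ (n + 1) (cometric G) Ω := fun x hx =>
    (h.contDiffAt_cometric hx hG).contDiffWithinAt
  have h1 : ContDiffOn ℝ (n + 1) (fun t => (z t).1) (Icc 0 ε) := hz1.fst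
  have h2 : ContDiffOn ℝ (n + 1) (fun t => (z t).2) (Icc 0 ε) := hz1.snd
  exact ((hA.comp h1 fun t ht => (hz t ht).2).clm_apply h2).congr fun t ht =>
    (hz.hasDerivWithinAt_fst ht).derivWithin (hu t ht)

/-- The Gauss lemma in finite differences: nearby geodesics `z`, `w` satisfy
`ξ(y - x)|₀^ε = ε (H(w) - H(z))` up to second order. -/
theorem gauss_estimate (h : IsLorentzChart Ω G T) (hε : 0 ≤ ε) (hz : IsGeodesic Ω G ε z)
    (hw : IsGeodesic Ω G ε w) {C d : ℝ} (hC : 0 ≤ C)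
    (hA : ∀ t ∈ Icc 0 ε, ‖cometric G (w t).1‖ ≤ C) (hξ : ∀ t ∈ Icc 0 ε, ‖(z t).2‖ ≤ C)
    (hT : ∀ t ∈ Icc 0 ε, ‖cometric G (w t).1 - cometric G (z t).1 -
      fderiv ℝ (cometric G) (z t).1 ((w t).1 - (z t).1)‖ ≤ C * ‖(w t).1 - (z t).1‖ ^ 2)
    (hd : ∀ t ∈ Icc 0 ε, ‖w t - z t‖ ≤ d) :
    ‖(z ε).2 ((w ε).1 - (z ε).1) - (z 0).2 ((w 0).1 - (z 0).1) -
      ε * ((1 / 2) * (cometricSq G (w 0) - cometricSq G (z 0)))‖ ≤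
      (C + C ^ 3) * d ^ 2 * ε := by
  set k := (1 / 2) * (cometricSq G (w 0) - cometricSq G (z 0)) with hk
  have key := norm_image_sub_le_of_norm_deriv_le_segment'
    (f := fun t => (z t).2 ((w t).1 - (z t).1) - t * k) (a := 0) (b := ε) (C := (C + C ^ 3) * d ^ 2)
    (fun t ht => ((hz.hasDerivWithinAt_snd ht).clm_apply ((hw.hasDerivWithinAt_fst ht).sub
      (hz.hasDerivWithinAt_fst ht))).sub ((hasDerivWithinAt_id t _).mul_const k)) ?_ ε
      (right_mem_Icc.2 hε)
  · simp only [zero_mul, sub_zero] at key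
    rwa [sub_right_comm] at key
  intro t ht'
  have ht := Ico_subset_Icc_self ht'
  set x := (z t).1 with hx
  set ξ := (z t).2 with hξ'
  set y := (w t).1 with hy
  set η := (w t).2 with hη
  have e1 : cometricSq G (w 0) = η (cometric G y η) := (hw.cometricSq_eq h ht).symm
  have e2 : cometricSq G (z 0) = ξ (cometric G x ξ) := (hz.cometricSq_eq h ht).symm
  have hyΩ : y ∈ Ω := (hw t ht).2
  have hd1 : ‖y - x‖ ≤ d := (norm_fst_le (w t - z t)).trans (hd t ht)
  have hd2 : ‖η - ξ‖ ≤ d := (norm_snd_le (w t - z t)).trans (hd t ht)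
  have hd0 : 0 ≤ d := (norm_nonneg _).trans hd1
  set F := cometric G y - cometric G x - fderiv ℝ (cometric G) x (y - x) with hF
  have b1 : ‖(η - ξ) (cometric G y (η - ξ))‖ ≤ d * (C * d) :=
    ((η - ξ).le_opNorm _).trans (mul_le_mul hd2 (((cometric G y).le_opNorm _).trans
      (mul_le_mul (hA t ht) hd2 (norm_nonneg _) hC)) (norm_nonneg _) hd0)
  have b2 : ‖ξ (F ξ)‖ ≤ C * ((C * d ^ 2) * C) := by
    refine (ξ.le_opNorm _).trans (mul_le_mul (hξ t ht) ((F.le_opNorm _).trans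
      (mul_le_mul ((hT t ht).trans ?_) (hξ t ht) (norm_nonneg _) (by positivity)))
      (norm_nonneg _) hC)
    gcongr
  -- Once conservation of energy moves `k` to time t, all first-order terms cancel. What remains is
  -- the Taylor remainder of the cometric and a form quadratic in η - ξ.
  have e3 : (-(1 / 2 : ℝ) • (ξ ∘L (fderiv ℝ (cometric G) x).flip ξ)) (y - x) +
      ξ (cometric G y η - cometric G x ξ) - 1 * k =
      (1 / 2) * (ξ (F ξ)) - (1 / 2) * ((η - ξ) (cometric G y (η - ξ))) := by
    rw [hk, e1, e2, hF]
    simp only [smul_apply, ContinuousLinearMap.comp_apply, ContinuousLinearMap.flip_apply,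
      smul_eq_mul, map_sub, sub_apply, h.cometric_symm hyΩ η ξ]
    ring
  refine (congrArg norm e3).trans_le ?_
  refine (norm_sub_le _ _).trans ?_
  rw [norm_mul, norm_mul]
  norm_num
  norm_num at b1 b2
  nlinarith [mul_nonneg hC (sq_nonneg d), mul_nonneg (pow_nonneg hC 3) (sq_nonneg d)]

end IsGeodesic

/-- The second order Taylor estimate, uniform in the base point. -/
theorem ContDiffAt.exists_taylor_two {F : Type*} [NormedAddCommGroup F] [NormedSpace ℝ F]
    {f : E → F} {x₀ : E} (hf : ContDiffAt ℝ 2 f x₀) :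
    ∃ C : ℝ, 0 ≤ C ∧ ∃ ρ > 0, ∀ x ∈ Metric.ball x₀ ρ, ∀ y ∈ Metric.ball x₀ ρ,
      ‖f y - f x - fderiv ℝ f x (y - x)‖ ≤ C * ‖y - x‖ ^ 2 := by
  have hD : ContDiffAt ℝ 1 (fderiv ℝ f) x₀ := hf.fderiv_right (by norm_num)
  obtain ⟨K, s, hs, hK⟩ := hD.exists_lipschitzOnWith
  have hdiff : ∀ᶠ x in 𝓝 x₀, DifferentiableAt ℝ f x :=
    (hf.eventually (by simp)).mono fun x hx => hx.differentiableAt two_ne_zero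
  obtain ⟨ρ, hρ, hball⟩ := Metric.mem_nhds_iff.1 (Filter.inter_mem hs hdiff)
  refine ⟨K, K.2, ρ, hρ, fun x hx y hy => ?_⟩
  have hseg : segment ℝ x y ⊆ Metric.ball x₀ ρ := (convex_ball x₀ ρ).segment_subset hx hy
  have := (convex_segment x y).norm_image_sub_le_of_norm_hasFDerivWithin_le' (f := f)
    (f' := fderiv ℝ f) (φ := fderiv ℝ f x) (C := K * ‖y - x‖)
    (fun u hu => ((hball (hseg hu)).2).hasFDerivAt.hasFDerivWithinAt)
    (fun u hu => ((hK.norm_sub_le (hball (hseg hu)).1 (hball hx).1)).trans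
      (mul_le_mul_of_nonneg_left (by
        have := norm_sub_le_of_mem_segment hu
        rwa [norm_sub_rev u x, norm_sub_rev x u] at this) K.2))
    (left_mem_segment ℝ x y) (right_mem_segment ℝ x y)
  rw [pow_two, ← mul_assoc]
  exact this

end Geodesics

/-! ### The exponential map and the Gauss lemma. -/

section Exponential

set_option maxSynthPendingDepth 3

variable {E : Type*} [NormedAddCommGroup E] [NormedSpace ℝ E]
  {Ω : Set E} {G : E → E →L[ℝ] E →L[ℝ] ℝ} {T : E}

/-- Any two points `q`, `y` of the open set `V` are joined by the geodesic `z q y`, whose initial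
momentum depends continuously on `q` and `y`; the squared length of this momentum is a function of
`y` whose derivative is given by the final momentum. -/
structure IsGeodesicFamily {E : Type*} [NormedAddCommGroup E] [NormedSpace ℝ E] (Ω : Set E)
    (G : E → E →L[ℝ] E →L[ℝ] ℝ) (V : Set E) (ε : ℝ) (z : E → E → ℝ → E × (E →L[ℝ] ℝ)) : Prop where
  isOpen : IsOpen V
  pos : 0 < ε
  joins : ∀ q ∈ V, ∀ y ∈ V, IsGeodesic Ω G ε (z q y) ∧ (z q y 0).1 = q ∧ (z q y ε).1 = y ∧
    ((z q y 0).2 ≠ 0 → ∀ t ∈ Icc 0 ε, (z q y t).2 ≠ 0) ∧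
    HasFDerivAt (fun y => cometricSq G (z q y 0)) ((2 * ε⁻¹) • (z q y ε).2) y
  continuousOn : ContinuousOn (fun p : E × E => (z p.1 p.2 0).2) (V ×ˢ V)
  self : ∀ q ∈ V, (z q q 0).2 = 0 ∧ HasFDerivAt (fun y => (z q y 0).2) (ε⁻¹ • G q) q
  eq_of_zero : ∀ q ∈ V, ∀ y ∈ V, (z q y 0).2 = 0 → q = y

/-- A covector at `q` which is the metric dual of a timelike future vector. -/
def IsTimelikeMomentum {E : Type*} [NormedAddCommGroup E] [NormedSpace ℝ E]
    (G : E → E →L[ℝ] E →L[ℝ] ℝ) (T : E) (z : E × (E →L[ℝ] ℝ)) : Prop :=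
  cometricSq G z < 0 ∧ z.2 T < 0

namespace IsGeodesicFamily

variable {V : Set E} {ε : ℝ} {z : E → E → ℝ → E × (E →L[ℝ] ℝ)} {q : E}

theorem mem_of_mem (hz : IsGeodesicFamily Ω G V ε z) {y : E} (hy : y ∈ V) : y ∈ Ω := by
  have h1 := hz.joins y hy y hy
  rw [← h1.2.1]
  exact (h1.1 0 (left_mem_Icc.2 hz.pos.le)).2

theorem isOpen_timelike (G : E → E →L[ℝ] E →L[ℝ] ℝ) (T q : E) :
    IsOpen {ξ : E →L[ℝ] ℝ | IsTimelikeMomentum G T (q, ξ)} := by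
  have h1 : Continuous fun ξ : E →L[ℝ] ℝ => ξ (cometric G q ξ) :=
    continuous_id.clm_apply ((cometric G q).continuous)
  have h2 : Continuous fun ξ : E →L[ℝ] ℝ => ξ T := continuous_id.clm_apply continuous_const
  exact (isOpen_lt h1 continuous_const).inter (isOpen_lt h2 continuous_const)

theorem isTimelikeMomentum_iff (hz : IsGeodesicFamily Ω G V ε z) (hq : q ∈ V) {y : E}
    (hy : y ∈ V) : IsTimelikeMomentum G T (z q y 0) ↔
      (z q y 0).2 ∈ {ξ : E →L[ℝ] ℝ | IsTimelikeMomentum G T (q, ξ)} := by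
  have : z q y 0 = (q, (z q y 0).2) := Prod.ext (hz.joins q hq y hy).2.1 rfl
  conv_lhs => rw [this]
  rfl

end IsGeodesicFamily

variable [FiniteDimensional ℝ E]

namespace IsLorentzChart

/-- The derivative at `(q, 0)` of the map sending `(q, ξ)` to the endpoints of its geodesic. -/
noncomputable def endpointsDeriv (h : IsLorentzChart Ω G T) {ε : ℝ} (hε : ε ≠ 0) {q : E}
    (hq : q ∈ Ω) : (E × (E →L[ℝ] ℝ)) ≃L[ℝ] (E × E) :=
  ContinuousLinearEquiv.equivOfInverse
    ((ContinuousLinearMap.fst ℝ E (E →L[ℝ] ℝ)).prod (ContinuousLinearMap.fst ℝ E (E →L[ℝ] ℝ) +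
      ε • (cometric G q ∘L ContinuousLinearMap.snd ℝ E (E →L[ℝ] ℝ))))
    ((ContinuousLinearMap.fst ℝ E E).prod (ε⁻¹ • (G q ∘L (ContinuousLinearMap.snd ℝ E E -
      ContinuousLinearMap.fst ℝ E E))))
    (fun z => by
      ext1
      · simp
      · simp [h.metric_cometric hq, smul_smul, inv_mul_cancel₀ hε])
    (fun z => by
      ext1
      · simp
      · simp [h.cometric_metric hq, smul_smul, mul_inv_cancel₀ hε, map_sub])

theorem endpointsDeriv_symm_apply (h : IsLorentzChart Ω G T) {ε : ℝ} (hε : ε ≠ 0) {q : E}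
    (hq : q ∈ Ω) (p : E × E) :
    (h.endpointsDeriv hε hq).symm p = (p.1, ε⁻¹ • G q (p.2 - p.1)) := rfl

/-- The map from (q, ξ) to the two endpoints of its geodesic is strictly differentiable at zero
momentum with invertible derivative, so it has a local inverse that is Lipschitz near (x₀, x₀).
Composed with the Lipschitz flow, it gives geodesics depending in a Lipschitz way on their
endpoints, which is what the finite-difference Gauss lemma needs. -/
theorem exists_geodesicFamily (h : IsLorentzChart Ω G T) {x₀ : E} (hx₀ : x₀ ∈ Ω) :
    ∃ (V : Set E) (ε : ℝ) (z : E → E → ℝ → E × (E →L[ℝ] ℝ)),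
      x₀ ∈ V ∧ IsGeodesicFamily Ω G V ε z := by
  have hA : ContDiffAt ℝ 2 (cometric G) x₀ := h.contDiffAt_cometric hx₀ h.contDiffOn
  have hX : ContDiffAt ℝ 1 (geodesicField G) (x₀, 0) :=
    (h.contDiffOn_geodesicField (n := 1) (h.contDiffOn.of_le (by norm_num))).contDiffAt
      ((h.isOpen.prod isOpen_univ).mem_nhds ⟨hx₀, mem_univ _⟩)
  obtain ⟨K, s, hs, hK⟩ := hX.exists_lipschitzOnWith
  obtain ⟨C₁, hC₁, ρ, hρ, hTaylor⟩ := hA.exists_taylor_two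
  -- A single constant bounding the Taylor remainder, the cometric and the momenta, as
  -- `gauss_estimate` uses one `C` for all three.
  set C := max (max C₁ (‖cometric G x₀‖ + 1)) 1 with hC
  have hCA : ∀ᶠ x in 𝓝 x₀, ‖cometric G x‖ < ‖cometric G x₀‖ + 1 :=
    (hA.continuousAt.norm).eventually_lt continuousAt_const (lt_add_one _)
  have hN : ∀ᶠ z : E × (E →L[ℝ] ℝ) in 𝓝 (x₀, 0), z ∈ s ∧ (z.1 ∈ Ω ∧ z.1 ∈ Metric.ball x₀ ρ ∧
      ‖cometric G z.1‖ ≤ C) ∧ ‖z.2‖ ≤ C := by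
    have hs' : ∀ᶠ z in 𝓝 ((x₀, 0) : E × (E →L[ℝ] ℝ)), z ∈ s := hs
    refine hs'.and (Filter.Eventually.and ?_ ?_)
    · refine continuousAt_fst.eventually (p := fun x => x ∈ Ω ∧ x ∈ Metric.ball x₀ ρ ∧
        ‖cometric G x‖ ≤ C) ?_
      filter_upwards [h.isOpen.mem_nhds hx₀, Metric.ball_mem_nhds x₀ hρ, hCA] with x h1 h2 h3
      exact ⟨h1, h2, h3.le.trans ((le_max_right _ _).trans (le_max_left _ _))⟩
    · refine continuousAt_snd.eventually (p := fun ξ => ‖ξ‖ ≤ C) ?_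
      filter_upwards [Metric.ball_mem_nhds (0 : E →L[ℝ] ℝ) one_pos] with ξ hξ
      exact (mem_ball_zero_iff.1 hξ).le.trans (le_max_right _ _)
  obtain ⟨W, hWN, hWo, hxW⟩ := mem_nhds_iff.1 hN
  have hKW : LipschitzOnWith K (geodesicField G) W := hK.mono fun z hz => (hWN hz).1
  obtain ⟨ε, hε, U₀, hU₀, α, L, hα, hL⟩ := exists_flow_of_equilibrium hX
    (geodesicField_zero x₀) (hWo.mem_nhds hxW) hKW
  set U := interior U₀ ∩ W with hU
  have hUo : IsOpen U := isOpen_interior.inter hWo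
  have hxU : ((x₀, 0) : E × (E →L[ℝ] ℝ)) ∈ U := ⟨mem_interior_iff_mem_nhds.2 hU₀, hxW⟩
  have hUU : U ⊆ U₀ := fun z hz => interior_subset hz.1
  have hUΩ : ∀ {q : E}, (q, (0 : E →L[ℝ] ℝ)) ∈ U → q ∈ Ω := fun hq => (hWN hq.2).2.1.1
  have hconst : ∀ q, (q, (0 : E →L[ℝ] ℝ)) ∈ U → ∀ t ∈ Icc 0 ε, α (q, 0) t = (q, 0) := fun q hq =>
    eq_of_hasDerivWithinAt_of_equilibrium (hWo.mem_nhds hq.2) hKW (geodesicField_zero q)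
      (hα _ (hUU hq)).1 fun t ht => ((hα _ (hUU hq)).2 t ht).1
  set Ψ : E × (E →L[ℝ] ℝ) → E × E := fun z => (z.1, (α z ε).1) with hΨ
  have hstrict : ∀ q (hq : (q, (0 : E →L[ℝ] ℝ)) ∈ U), HasStrictFDerivAt Ψ
      (h.endpointsDeriv hε.ne' (hUΩ hq) : (E × (E →L[ℝ] ℝ)) →L[ℝ] (E × E)) (q, 0) := by
    intro q hq
    have h1 := hasStrictFDerivAt_flow_of_sq_zero (h.hasStrictFDerivAt_geodesicField (hUΩ hq))
      (by ext <;> simp) hε (hUo.mem_nhds hq) (fun z hz => (hα z (hUU hz)).1)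
      (fun z hz t ht => ((hα z (hUU hz)).2 t ht).1) (fun t ht => (hL t ht).mono hUU)
      (hconst q hq)
    refine (hasStrictFDerivAt_fst.prodMk (hasStrictFDerivAt_fst.comp (q, 0) h1)).congr_fderiv ?_
    ext <;> simp [endpointsDeriv]
  set e := (hstrict x₀ hxU).toOpenPartialHomeomorph Ψ with he
  have hesrc : ((x₀, 0) : E × (E →L[ℝ] ℝ)) ∈ e.source :=
    (hstrict x₀ hxU).mem_toOpenPartialHomeomorph_source
  have heΨ : ∀ z, e z = Ψ z := fun z => rfl
  have hΨ0 : ∀ q, (q, (0 : E →L[ℝ] ℝ)) ∈ U → Ψ (q, 0) = (q, q) := fun q hq => by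
    simp [hΨ, hconst q hq ε (right_mem_Icc.2 hε.le)]
  have hetgt : (x₀, x₀) ∈ e.target := by
    rw [← hΨ0 x₀ hxU, ← heΨ]; exact e.map_source hesrc
  have hsymm0 : ∀ q, (q, (0 : E →L[ℝ] ℝ)) ∈ U → (q, (0 : E →L[ℝ] ℝ)) ∈ e.source →
      e.symm (q, q) = (q, 0) := fun q hq hqs => by
    rw [← hΨ0 q hq, ← heΨ]; exact e.left_inv hqs
  have hsymmderiv : ∀ q (hq : (q, (0 : E →L[ℝ] ℝ)) ∈ U), (q, (0 : E →L[ℝ] ℝ)) ∈ e.source →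
      HasStrictFDerivAt e.symm ((h.endpointsDeriv hε.ne' (hUΩ hq)).symm :
        (E × E) →L[ℝ] (E × (E →L[ℝ] ℝ))) (q, q) := fun q hq hqs => by
    refine e.hasStrictFDerivAt_symm ?_ ?_
    · rw [← hΨ0 q hq, ← heΨ]; exact e.map_source hqs
    · rw [hsymm0 q hq hqs]; exact hstrict q hq
  obtain ⟨K₂, s₂, hs₂, hK₂⟩ := (hsymmderiv x₀ hxU hesrc).exists_lipschitzOnWith
  have hsymmU : ∀ᶠ p in 𝓝 (x₀, x₀), e.symm p ∈ U := by
    refine (e.continuousAt_symm hetgt).eventually ?_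
    rw [hsymm0 x₀ hxU hesrc]
    exact hUo.mem_nhds hxU
  have hgood := Filter.inter_mem (Filter.inter_mem (e.open_target.mem_nhds hetgt) hs₂) hsymmU
  rw [nhds_prod_eq, Filter.mem_prod_self_iff] at hgood
  obtain ⟨V₀, hV₀, hV₀good⟩ := hgood
  have hqcont : Continuous fun q : E => (q, (0 : E →L[ℝ] ℝ)) := by fun_prop
  have hV₁ : ∀ᶠ q in 𝓝 x₀, (q, (0 : E →L[ℝ] ℝ)) ∈ U ∩ e.source :=
    hqcont.continuousAt.eventually ((hUo.inter e.open_source).mem_nhds ⟨hxU, hesrc⟩)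
  obtain ⟨V, hVsub, hVo, hxV⟩ := mem_nhds_iff.1 (Filter.inter_mem hV₀ hV₁)
  have hV : ∀ q ∈ V, ∀ y ∈ V, (q, y) ∈ e.target ∧ (q, y) ∈ s₂ ∧ e.symm (q, y) ∈ U :=
    fun q hq y hy =>
      have := hV₀good (mk_mem_prod (hVsub hq).1 (hVsub hy).1)
      ⟨this.1.1, this.1.2, this.2⟩
  refine ⟨V, ε, fun q y => α (e.symm (q, y)), hxV, hVo, hε, fun q hq y hy => ?_, ?_,
    fun q hq => ⟨?_, ?_⟩, fun q hq y hy h0 => ?_⟩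
  · have hinit : ∀ y ∈ V, α (e.symm (q, y)) 0 = e.symm (q, y) := fun y hy =>
      (hα _ (hUU (hV q hq y hy).2.2)).1
    have hgeo : ∀ y ∈ V, IsGeodesic Ω G ε (α (e.symm (q, y))) := fun y hy t ht =>
      have := (hα _ (hUU (hV q hq y hy).2.2)).2 t ht
      ⟨this.1, (hWN this.2).2.1.1⟩
    have hW : ∀ y ∈ V, ∀ t ∈ Icc 0 ε, α (e.symm (q, y)) t ∈ W := fun y hy t ht =>
      ((hα _ (hUU (hV q hq y hy).2.2)).2 t ht).2
    have hends : ∀ y ∈ V, Ψ (e.symm (q, y)) = (q, y) := fun y hy => by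
      rw [← heΨ]; exact e.right_inv (hV q hq y hy).1
    have hfst : ∀ y ∈ V, (α (e.symm (q, y)) 0).1 = q := fun y hy => by
      rw [hinit y hy]; exact congrArg Prod.fst (hends y hy)
    have hlst : ∀ y ∈ V, (α (e.symm (q, y)) ε).1 = y := fun y hy =>
      congrArg Prod.snd (hends y hy)
    refine ⟨hgeo y hy, hfst y hy, hlst y hy, ?_, ?_⟩
    · intro hne t ht h0
      apply hne
      have hsub : Icc 0 t ⊆ Icc 0 ε := Icc_subset_Icc_right ht.2
      have hcont : ContinuousOn (α (e.symm (q, y))) (Icc 0 ε) := fun s hs =>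
        (hgeo y hy s hs).1.continuousWithinAt
      have hzt : α (e.symm (q, y)) t = ((α (e.symm (q, y)) t).1, 0) := Prod.ext rfl h0
      -- Zero momentum is an equilibrium, so by backward uniqueness a momentum vanishing at time t
      -- vanishes at time 0 as well.
      have := ODE_solution_unique_of_mem_Icc_left (v := fun _ => geodesicField G)
        (s := fun _ => W) (K := K) (f := α (e.symm (q, y))) (g := fun _ => α (e.symm (q, y)) t)
        (a := 0) (b := t) (fun _ _ => hKW) (hcont.mono hsub)
        (fun s hs => ((hgeo y hy s (hsub (Ioc_subset_Icc_self hs))).1).mono_of_mem_nhdsWithin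
          (Filter.mem_of_superset (Icc_mem_nhdsLE hs.1)
            (Icc_subset_Icc_right (hs.2.trans ht.2))))
        (fun s hs => hW y hy s (hsub (Ioc_subset_Icc_self hs)))
        continuousOn_const
        (fun s hs => by
          rw [hzt, geodesicField_zero]; exact hasDerivWithinAt_const _ _ _)
        (fun s hs => hW y hy t ht) rfl (left_mem_Icc.2 ht.1)
      exact (congrArg Prod.snd this).trans h0
    -- Geodesics from q to y and to y' stay within L K₂ ‖y' - y‖ of each other, and their common
    -- starting point kills the initial term of the Gauss estimate. The remainder is therefore
    -- quadratic, which proves differentiability in y.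
    · have hbig : (fun y' => cometricSq G (α (e.symm (q, y')) 0) -
          ((2 * ε⁻¹) • (α (e.symm (q, y)) ε).2) (y' - y) - cometricSq G (α (e.symm (q, y)) 0))
          =O[𝓝 y] fun y' => ‖y' - y‖ ^ 2 := by
        refine Asymptotics.IsBigO.of_bound (2 * ((C + C ^ 3) * (L * K₂) ^ 2)) ?_
        filter_upwards [hVo.mem_nhds hy] with y' hy'
        have hg := (hgeo y hy).gauss_estimate h hε.le (hgeo y' hy') (C := C)
          (d := L * (K₂ * ‖y' - y‖)) (zero_le_one.trans (le_max_right _ _))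
          (fun t ht => (hWN (hW y' hy' t ht)).2.1.2.2) (fun t ht => (hWN (hW y hy t ht)).2.2)
          (fun t ht => (hTaylor _ (hWN (hW y hy t ht)).2.1.2.1 _
            (hWN (hW y' hy' t ht)).2.1.2.1).trans (mul_le_mul_of_nonneg_right
              ((le_max_left _ _).trans (le_max_left _ _)) (sq_nonneg _)))
          (fun t ht => ((hL t ht).norm_sub_le (hUU (hV q hq y' hy').2.2)
            (hUU (hV q hq y hy).2.2)).trans (mul_le_mul_of_nonneg_left (by
              refine (hK₂.norm_sub_le (hV q hq y' hy').2.1 (hV q hq y hy).2.1).trans ?_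
              simp) L.2))
        rw [hfst y hy, hfst y' hy', hlst y hy, hlst y' hy', sub_self, map_zero, sub_zero] at hg
        rw [norm_pow, norm_norm]
        have e1 : cometricSq G (α (e.symm (q, y')) 0) -
            ((2 * ε⁻¹) • (α (e.symm (q, y)) ε).2) (y' - y) - cometricSq G (α (e.symm (q, y)) 0) =
            -(2 * ε⁻¹) * ((α (e.symm (q, y)) ε).2 (y' - y) - ε * (1 / 2 *
              (cometricSq G (α (e.symm (q, y')) 0) - cometricSq G (α (e.symm (q, y)) 0)))) := by
          rw [smul_apply, smul_eq_mul]
          field_simp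
          ring
        rw [e1, norm_mul]
        have hn : ‖-(2 * ε⁻¹)‖ = 2 * ε⁻¹ := by
          rw [norm_neg, Real.norm_of_nonneg (by positivity)]
        rw [hn]
        refine (mul_le_mul_of_nonneg_left hg (by positivity)).trans (le_of_eq ?_)
        field_simp
      have h0 := hbig.hasFDerivAt (𝕜 := ℝ) one_lt_two
      have hlin : HasFDerivAt (fun y' => ((2 * ε⁻¹) • (α (e.symm (q, y)) ε).2) (y' - y))
          ((2 * ε⁻¹) • (α (e.symm (q, y)) ε).2) y :=
        (ContinuousLinearMap.hasFDerivAt _).comp y ((hasFDerivAt_id y).sub_const y)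
      have h1 := (h0.add_const (cometricSq G (α (e.symm (q, y)) 0))).add hlin
      refine (h1.congr_fderiv (by ext; simp)).congr_of_eventuallyEq (Filter.Eventually.of_forall ?_)
      intro y'
      simp
  · have hcont : ContinuousOn (fun p => (e.symm p).2) (V ×ˢ V) := fun p hp =>
      ((e.continuousAt_symm (hV p.1 hp.1 p.2 hp.2).1).snd).continuousWithinAt
    refine hcont.congr fun p hp => ?_
    exact congrArg Prod.snd (hα _ (hUU (hV p.1 hp.1 p.2 hp.2).2.2)).1
  · have h1 := hsymm0 q (hVsub hq).2.1 (hVsub hq).2.2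
    simp only [h1, (hα _ (hUU (hVsub hq).2.1)).1]
  · have h1 := (hsymmderiv q (hVsub hq).2.1 (hVsub hq).2.2).hasFDerivAt
    have h2 := hasFDerivAt_prodMk_right (𝕜 := ℝ) q q
    have h3 := (hasFDerivAt_snd.comp q (h1.comp q h2))
    refine (h3.congr_fderiv ?_).congr_of_eventuallyEq ?_
    · ext; simp [endpointsDeriv_symm_apply]
    · filter_upwards [hVo.mem_nhds hq] with y hy
      exact congrArg Prod.snd (hα _ (hUU (hV q hq y hy).2.2)).1
  · have h1 : Ψ (e.symm (q, y)) = (q, y) := by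
      rw [← heΨ]; exact e.right_inv (hV q hq y hy).1
    have h3 : (e.symm (q, y)).1 = q := congrArg Prod.fst h1
    have h2 : e.symm (q, y) = (q, 0) :=
      Prod.ext h3
        ((congrArg Prod.snd (hα _ (hUU (hV q hq y hy).2.2)).1).symm.trans h0)
    rw [h2, hΨ0 q (hVsub hq).2.1] at h1
    exact congrArg Prod.snd h1

end IsLorentzChart

namespace IsGeodesicFamily

variable {V : Set E} {ε : ℝ} {z : E → E → ℝ → E × (E →L[ℝ] ℝ)} {q : E} {c : ℝ → E} {a b : ℝ}

/-- A future causal curve starting in the image of the timelike future cone under the exponential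
map at `q` stays there, as long as it remains in the domain of the geodesic family. -/
theorem timelike_of_causal_curve (hz : IsGeodesicFamily Ω G V ε z) (h : IsLorentzChart Ω G T)
    (hq : q ∈ V) (hc : ContinuousOn c (Icc a b)) (hcV : ∀ t ∈ Icc a b, c t ∈ V)
    (hd : ∀ t ∈ Ico a b, ∃ v, HasDerivWithinAt c v (Ici t) t ∧ G (c t) v v ≤ 0 ∧ G (c t) v T < 0)
    (ha : IsTimelikeMomentum G T (z q (c a) 0)) :
    ∀ t ∈ Icc a b, IsTimelikeMomentum G T (z q (c t) 0) := by
  have hεpos := hz.pos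
  have hΩ : ∀ y ∈ V, y ∈ Ω := fun y hy => hz.mem_of_mem hy
  set η : ℝ → E →L[ℝ] ℝ := fun t => (z q (c t) 0).2 with hη
  set P : Set (E →L[ℝ] ℝ) := {ξ | IsTimelikeMomentum G T (q, ξ)} with hP
  have hPo : IsOpen P := isOpen_timelike G T q
  have hsq : ∀ t ∈ Icc a b, cometricSq G (z q (c t) 0) = η t (cometric G q (η t)) := fun t ht => by
    rw [cometricSq, (hz.joins q hq (c t) (hcV t ht)).2.1]
  have hηc : ContinuousOn η (Icc a b) :=
    hz.continuousOn.comp (continuousOn_const.prodMk hc) fun t ht => ⟨hq, hcV t ht⟩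
  intro tb htb
  rw [hz.isTimelikeMomentum_iff hq (hcV tb htb)]
  by_contra htbP
  have hP₀ : η a ∈ P :=
    (hz.isTimelikeMomentum_iff hq (hcV a ⟨le_rfl, htb.1.trans htb.2⟩)).1 ha
  have hScl : IsClosed (Icc a b ∩ η ⁻¹' Pᶜ) :=
    hηc.preimage_isClosed_of_isClosed isClosed_Icc hPo.isClosed_compl
  have hScomp : IsCompact (Icc a b ∩ η ⁻¹' Pᶜ) :=
    isCompact_Icc.of_isClosed_subset hScl inter_subset_left
  -- t₁ is the first parameter at which the momentum leaves the open timelike future cone.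
  obtain ⟨t₁, ⟨ht₁, ht₁P⟩, hleast⟩ := hScomp.exists_isLeast ⟨tb, htb, htbP⟩
  have hgood : ∀ t ∈ Ico a t₁, η t ∈ P := by
    intro t ht
    by_contra hn
    exact absurd (hleast ⟨⟨ht.1, ht.2.le.trans ht₁.2⟩, hn⟩) (not_le.2 ht.2)
  have hsub1 : Icc a t₁ ⊆ Icc a b := Icc_subset_Icc_right ht₁.2
  have hat₁ : a ≤ t₁ := ht₁.1
  -- By the Gauss lemma the derivative is 2/ε times the final momentum evaluated on the velocity.
  -- That momentum is dual to a future timelike vector, so it is negative on future causal vectors.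
  have hderiv : ∀ t ∈ Ico a t₁, ∃ d ≤ (0 : ℝ),
      HasDerivWithinAt (fun t => cometricSq G (z q (c t) 0)) d (Ici t) t := by
    intro t ht
    have htab := hsub1 (Ico_subset_Icc_self ht)
    have hcV' := hcV t htab
    obtain ⟨v, hv, hvv, hvT⟩ := hd t ⟨htab.1, ht.2.trans_le ht₁.2⟩
    obtain ⟨hgeo, hini, hfin, hne, hder⟩ := hz.joins q hq (c t) hcV'
    have hPt := hgood t ht
    have hη0 : (z q (c t) 0).2 ≠ 0 := by
      intro h0
      have h2 := hPt.2
      simp only [hη, h0] at h2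
      simp at h2
    have hεmem : ε ∈ Icc 0 ε := right_mem_Icc.2 hz.pos.le
    have hS0 : cometricSq G (z q (c t) 0) < 0 := by rw [hsq t htab]; exact hPt.1
    have hSε := hgeo.cometricSq_eq h hεmem
    have hTε := hgeo.apply_neg h hS0.le hPt.2 (hne hη0) hεmem
    have hcΩ := hΩ _ hcV'
    have e := h.metric_cometric hcΩ (z q (c t) ε).2
    refine ⟨_, ?_, hder.comp_hasDerivWithinAt t hv⟩
    rw [smul_apply, smul_eq_mul]
    refine mul_nonpos_of_nonneg_of_nonpos (by positivity) ?_
    rw [← e]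
    refine (lorentz_neg_of_future (h.symm _ hcΩ) (T := T) (fun u hu => ?_) ?_ hvv ?_ hvT).le
    · by_cases hu0 : u = 0
      · simp [hu0]
      · exact (h.spacelike _ hcΩ u hu0 hu).le
    · rw [e]
      rw [cometricSq, hfin] at hSε
      rw [hSε]; exact hS0
    · rw [e]; exact hTε
  choose! d hd0 hdd using hderiv
  have hSc : ContinuousOn (fun t => cometricSq G (z q (c t) 0)) (Icc a t₁) := by
    have : ContinuousOn (fun t => η t (cometric G q (η t))) (Icc a t₁) :=
      (hηc.mono hsub1).clm_apply ((cometric G q).continuous.comp_continuousOn (hηc.mono hsub1))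
    exact this.congr fun t ht => hsq t (hsub1 ht)
  have hle := image_le_of_deriv_right_le_deriv_boundary hSc hdd (B := fun _ =>
    cometricSq G (z q (c a) 0)) (B' := fun _ => 0) le_rfl continuousOn_const
    (fun t _ => hasDerivWithinAt_const _ _ _) hd0 (right_mem_Icc.2 hat₁)
  have hS1 : η t₁ (cometric G q (η t₁)) < 0 := by
    rw [← hsq t₁ (hsub1 (right_mem_Icc.2 hat₁))]
    refine hle.trans_lt ?_
    rw [hsq a (hsub1 (left_mem_Icc.2 hat₁))]; exact hP₀.1
  rcases lt_or_ge (η t₁ T) 0 with hT1 | hT1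
  · exact ht₁P ⟨hS1, hT1⟩
  -- The sign can only change at t₁ itself; there the momentum is still timelike and cannot
  -- annihilate `T`.
  obtain ⟨s, hs, hs0⟩ := intermediate_value_Icc hat₁ (f := fun t => η t T)
    ((hηc.mono hsub1).clm_apply continuousOn_const) ⟨hP₀.2.le, hT1⟩
  replace hs0 : η s T = 0 := hs0
  rcases hs.2.lt_or_eq with hlt | rfl
  · exact absurd (hgood s ⟨hs.1, hlt⟩).2 (by rw [hs0]; exact lt_irrefl _)
  have e := h.metric_cometric (hΩ q hq) (η s)
  refine lorentz_ne_zero_of_causal (h.spacelike q (hΩ q hq)) (v := cometric G q (η s)) ?_ ?_ ?_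
  · intro h0
    rw [h0, map_zero] at hS1
    exact lt_irrefl _ hS1
  · rw [e]; exact hS1.le
  · rw [e]; exact hs0

/-- A future causal curve which is timelike at its start `q` stays in the image of the timelike
future cone under the exponential map at `q`. -/
theorem timelike_of_curve (hz : IsGeodesicFamily Ω G V ε z) (h : IsLorentzChart Ω G T)
    (hq : q ∈ V) (hc : ContinuousOn c (Icc a b)) (hcV : ∀ t ∈ Icc a b, c t ∈ V) (hca : c a = q)
    (hd : ∀ t ∈ Ico a b, ∃ v, HasDerivWithinAt c v (Ici t) t ∧ G (c t) v v ≤ 0 ∧ G (c t) v T < 0)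
    (ha : ∃ v, HasDerivWithinAt c v (Ici a) a ∧ G q v v < 0 ∧ G q v T < 0) :
    ∀ t ∈ Ioc a b, IsTimelikeMomentum G T (z q (c t) 0) := by
  intro tb htb
  set η : ℝ → E →L[ℝ] ℝ := fun t => (z q (c t) 0).2 with hη
  set P : Set (E →L[ℝ] ℝ) := {ξ | IsTimelikeMomentum G T (q, ξ)} with hP
  have hPo : IsOpen P := isOpen_timelike G T q
  -- The momentum vanishes at a and has right derivative ε⁻¹ G v, which lies in the open cone. The
  -- difference quotients therefore enter the cone, and so does the momentum, a positive multiple of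
  -- them.
  have hstart : ∀ᶠ t in 𝓝[>] a, η t ∈ P := by
    obtain ⟨v, hv, hvv, hvT⟩ := ha
    have hself := (hz.self q hq).2
    rw [← hca] at hself
    have h1 : HasDerivWithinAt η ((ε⁻¹ • G (c a)) v) (Ici a) a := by
      have := hself.comp_hasDerivWithinAt a hv
      simpa only [hca] using! this
    have hη0 : η a = 0 := by rw [hη]; simp only [hca]; exact (hz.self q hq).1
    rw [hca, hasDerivWithinAt_iff_tendsto_slope, Ici_sdiff_left] at h1
    have hmem : (ε⁻¹ • G q) v ∈ P := by
      simp only [hP, mem_ofPred_eq, IsTimelikeMomentum, cometricSq, smul_apply, map_smul,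
        smul_eq_mul, h.cometric_metric (hz.mem_of_mem hq)]
      have : 0 < ε⁻¹ := inv_pos.2 hz.pos
      exact ⟨mul_neg_of_pos_of_neg this (mul_neg_of_pos_of_neg this hvv),
        mul_neg_of_pos_of_neg this hvT⟩
    filter_upwards [h1 (hPo.mem_nhds hmem), self_mem_nhdsWithin] with t ht hta
    have hpos : 0 < t - a := sub_pos.2 hta
    have e : η t = (t - a) • slope η a t := by
      rw [slope_def_module, hη0, sub_zero, smul_smul, mul_inv_cancel₀ hpos.ne', one_smul]
    have ht' : slope η a t ∈ P := ht
    rw [e]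
    simp only [hP, mem_ofPred_eq, IsTimelikeMomentum, cometricSq, smul_apply, map_smul,
      smul_eq_mul] at ht' ⊢
    exact ⟨mul_neg_of_pos_of_neg hpos (mul_neg_of_pos_of_neg hpos ht'.1),
      mul_neg_of_pos_of_neg hpos ht'.2⟩
  obtain ⟨t₂, ht₂, hstart'⟩ := (mem_nhdsGT_iff_exists_Ioc_subset).1 hstart
  set t₀ := min t₂ tb with ht₀
  have hat₀ : a < t₀ := lt_min ht₂ htb.1
  have ht₀b : t₀ ≤ tb := min_le_right _ _
  have hsub : Icc t₀ tb ⊆ Icc a b := Icc_subset_Icc hat₀.le htb.2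
  refine hz.timelike_of_causal_curve h hq (hc.mono hsub) (fun t ht => hcV t (hsub ht))
    (fun t ht => hd t ⟨hat₀.le.trans ht.1, ht.2.trans_le htb.2⟩) ?_ tb ⟨ht₀b, le_rfl⟩
  exact (hz.isTimelikeMomentum_iff hq (hcV t₀ (hsub ⟨le_rfl, ht₀b⟩))).2
    (hstart' ⟨hat₀, min_le_left _ _⟩)

end IsGeodesicFamily

end Exponential

/-! ### The metric and the future cone in coordinates. -/

/-- Cauchy–Schwarz on the spatial coordinates gives a₀² b₀² ≤ A B with B < b₀², where A and B are
the spatial squares. So A ≤ a₀² would force A = 0, then a₀ = 0. -/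
theorem minkowski_pos_of_orthogonal {n : ℕ} {a b : Fin n → ℝ}
    (hb : ∑ i, b i * b i * (if (i : ℕ) = 0 then -1 else 1) < 0)
    (hab : ∑ i, a i * b i * (if (i : ℕ) = 0 then -1 else 1) = 0) (ha : a ≠ 0) :
    0 < ∑ i, a i * a i * (if (i : ℕ) = 0 then -1 else 1) := by
  cases n with
  | zero => exact absurd (Subsingleton.elim a 0) ha
  | succ k =>
    simp only [Fin.sum_univ_succ, Fin.val_zero, Fin.val_succ, if_true, Nat.succ_ne_zero, if_false,
      mul_neg, mul_one] at hb hab ⊢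
    have hcs := Finset.sum_mul_sq_le_sq_mul_sq Finset.univ (fun i : Fin k => a i.succ)
      fun i => b i.succ
    simp only [pow_two] at hcs
    set A := ∑ i : Fin k, a i.succ * a i.succ with hA
    set B := ∑ i : Fin k, b i.succ * b i.succ with hB
    have hA0 : 0 ≤ A := Finset.sum_nonneg fun i _ => mul_self_nonneg _
    have hB0 : 0 ≤ B := Finset.sum_nonneg fun i _ => mul_self_nonneg _
    have hAB : ∑ i : Fin k, a i.succ * b i.succ = a 0 * b 0 := by linarith
    rw [hAB] at hcs
    have hb0 : 0 < b 0 * b 0 := by linarith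
    by_contra hcon
    have h1 : A ≤ a 0 * a 0 := by linarith
    have h2 : A = 0 := by
      by_contra hne
      have hpos : 0 < A := lt_of_le_of_ne hA0 (Ne.symm hne)
      nlinarith [mul_pos hpos (show 0 < b 0 * b 0 - B by linarith),
        mul_nonneg (show 0 ≤ a 0 * a 0 - A by linarith) hb0.le]
    have h3 : a 0 = 0 := by
      rw [h2, zero_mul] at hcs
      have h4 : a 0 * b 0 = 0 := mul_self_eq_zero.1 (le_antisymm hcs (mul_self_nonneg _))
      rcases mul_eq_zero.1 h4 with h | h
      · exact h
      · rw [h] at hb0; simp at hb0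
    refine ha (funext fun i => ?_)
    refine Fin.cases h3 (fun j => ?_) i
    have := (Finset.sum_eq_zero_iff_of_nonneg fun i _ => mul_self_nonneg (a (Fin.succ i))).1 h2 j
      (Finset.mem_univ j)
    exact mul_self_eq_zero.1 this

namespace Spacetime

variable {n : ℕ} {r : ℕ∞} {M : Type*} [TopologicalSpace M]
  [ChartedSpace (EuclideanSpace ℝ (Fin n)) M] [IsManifold (𝓡 n) 1 M]

theorem pos_of_orthogonal_timelike (S : Spacetime n r M) {x : M} {T u : TangentSpace (𝓡 n) x}
    (hT : S.g x T T < 0) (hu : u ≠ 0) (huT : S.g x u T = 0) : 0 < S.g x u u := by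
  obtain ⟨e, he⟩ := S.lorentzian x
  have key : ∀ v w : TangentSpace (𝓡 n) x, S.g x v w =
      ∑ i, e.repr v i * e.repr w i * (if (i : ℕ) = 0 then -1 else 1) := by
    intro v w
    conv_lhs => rw [← e.sum_repr v, ← e.sum_repr w]
    simp only [map_sum, map_smul, sum_apply, smul_apply, he, smul_eq_mul]
    refine Finset.sum_congr rfl fun i _ => ?_
    rw [Finset.sum_eq_single i]
    · simp only [if_true]; ring
    · intro j _ hj
      rw [if_neg (by tauto)]; simp
    · intro h; exact absurd (Finset.mem_univ i) h
  rw [key] at hT huT ⊢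
  refine minkowski_pos_of_orthogonal hT huT fun h => hu ?_
  apply e.repr.injective
  ext i
  simpa using congrFun h i

/-- The inverse of the trivialization of the tangent bundle given by the chart at `p`. -/
noncomputable def chartLift (p y : M) : EuclideanSpace ℝ (Fin n) →L[ℝ] TangentSpace (𝓡 n) y :=
  (trivializationAt (EuclideanSpace ℝ (Fin n)) (TangentSpace (𝓡 n)) p).symmL ℝ y

/-- The metric in the coordinates of the chart at `p`. -/
noncomputable def chartMetric (S : Spacetime n r M) (p : M) (x : EuclideanSpace ℝ (Fin n)) :
    EuclideanSpace ℝ (Fin n) →L[ℝ] EuclideanSpace ℝ (Fin n) →L[ℝ] ℝ :=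
  (ContinuousLinearMap.precomp ℝ (chartLift p ((extChartAt (𝓡 n) p).symm x))) ∘L
    (S.g ((extChartAt (𝓡 n) p).symm x)) ∘L (chartLift p ((extChartAt (𝓡 n) p).symm x))

theorem chartLift_mfderiv {p y : M} (hy : y ∈ (chartAt (EuclideanSpace ℝ (Fin n)) p).source)
    (v : TangentSpace (𝓡 n) y) :
    chartLift p y (mfderiv (𝓡 n) 𝓘(ℝ, EuclideanSpace ℝ (Fin n)) (extChartAt (𝓡 n) p) y v) = v := by
  rw [← TangentBundle.continuousLinearMapAt_trivializationAt hy]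
  exact Bundle.Trivialization.symmL_continuousLinearMapAt _ (by simpa using hy) v

theorem mfderiv_chartLift {p y : M} (hy : y ∈ (chartAt (EuclideanSpace ℝ (Fin n)) p).source)
    (v : EuclideanSpace ℝ (Fin n)) :
    mfderiv (𝓡 n) 𝓘(ℝ, EuclideanSpace ℝ (Fin n)) (extChartAt (𝓡 n) p) y (chartLift p y v) = v := by
  rw [← TangentBundle.continuousLinearMapAt_trivializationAt hy]
  exact Bundle.Trivialization.continuousLinearMapAt_symmL _ (by simpa using hy) v

/-- The tangent bundle of a C^r manifold is a C^(r-1) bundle, so the coordinate frame fields are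
C^(r-1) sections; the coefficients are the metric evaluated on them. -/
theorem contDiffOn_chartMetric (S : Spacetime n r M) (hr : 1 ≤ r)
    [IsManifold (𝓡 n) (r : ℕ∞ω) M] (p : M) :
    ContDiffOn ℝ ((r - 1 : ℕ∞) : ℕ∞ω) (S.chartMetric p) (extChartAt (𝓡 n) p).target := by
  have hr' : (((r - 1 : ℕ∞) : ℕ∞ω)) + 1 = (r : ℕ∞ω) := by
    have : r - 1 + 1 = r := tsub_add_cancel_of_le hr
    exact_mod_cast congrArg (fun k : ℕ∞ => (k : ℕ∞ω)) this
  have : IsManifold (𝓡 n) ((((r - 1 : ℕ∞) : ℕ∞ω)) + 1) M := by rw [hr']; infer_instance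
  have : IsManifold (𝓡 n) ((r - 1 : ℕ∞) : ℕ∞ω) M :=
    IsManifold.of_le (n := ((((r - 1 : ℕ∞) : ℕ∞ω)) + 1)) le_self_add
  have : ContMDiffVectorBundle ((r - 1 : ℕ∞) : ℕ∞ω) (EuclideanSpace ℝ (Fin n))
      (TangentSpace (𝓡 n) : M → Type _) (𝓡 n) := TangentBundle.contMDiffVectorBundle
  set e := trivializationAt (EuclideanSpace ℝ (Fin n)) (TangentSpace (𝓡 n) (M := M)) p with he
  have hlift : ∀ v : EuclideanSpace ℝ (Fin n), ContMDiffOn (𝓡 n) (𝓡 n).tangent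
      ((r - 1 : ℕ∞) : ℕ∞ω)
      (fun y => (⟨y, chartLift p y v⟩ : TangentBundle (𝓡 n) M)) e.baseSet := by
    intro v
    rw [e.contMDiffOn_section_baseSet_iff]
    refine (contMDiffOn_const (c := v)).congr fun y hy => ?_
    have := e.apply_mk_symm hy v
    simp only [chartLift, ← he]
    rw [Bundle.Trivialization.symmL_apply _ hy, this]
  have hbase : e.baseSet = (chartAt (EuclideanSpace ℝ (Fin n)) p).source := by
    simp [he]
  refine contDiffOn_clm_apply.2 fun v => contDiffOn_clm_apply.2 fun w => ?_
  have h1 : ContMDiffOn (𝓡 n) 𝓘(ℝ) ((r - 1 : ℕ∞) : ℕ∞ω)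
      (fun y => S.g y (chartLift p y v) (chartLift p y w)) e.baseSet := by
    intro y hy
    have : ContMDiffWithinAt (𝓡 n) ((𝓡 n).prod 𝓘(ℝ)) ((r - 1 : ℕ∞) : ℕ∞ω)
        (fun m ↦ Bundle.TotalSpace.mk' ℝ (E := Bundle.Trivial M ℝ) m
          (S.g m (chartLift p m v) (chartLift p m w))) e.baseSet y := by
      apply ContMDiffWithinAt.clm_bundle_apply₂ (F₁ := EuclideanSpace ℝ (Fin n))
        (F₂ := EuclideanSpace ℝ (Fin n))
      · exact S.contMDiff.contMDiffAt.contMDiffWithinAt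
      · exact hlift v y hy
      · exact hlift w y hy
    simp only [Bundle.contMDiffWithinAt_totalSpace] at this
    exact this.2
  have h2 := h1.comp (contMDiffOn_extChartAt_symm (I := 𝓡 n) (n := ((r - 1 : ℕ∞) : ℕ∞ω)) p)
    (fun x hx => by
      rw [hbase, ← extChartAt_source (𝓡 n)]
      exact (extChartAt (𝓡 n) p).map_target hx)
  exact h2.contDiffOn

end Spacetime

namespace Spacetime

variable {n : ℕ} {r : ℕ∞} {M : Type*} [TopologicalSpace M]
  [ChartedSpace (EuclideanSpace ℝ (Fin n)) M] [IsManifold (𝓡 n) 1 M]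

/-- The derivative of the chart at `p`. -/
noncomputable def chartDeriv (p y : M) : TangentSpace (𝓡 n) y →L[ℝ] EuclideanSpace ℝ (Fin n) :=
  mfderiv (𝓡 n) 𝓘(ℝ, EuclideanSpace ℝ (Fin n)) (extChartAt (𝓡 n) p) y

theorem chartLift_chartDeriv {p y : M} (hy : y ∈ (chartAt (EuclideanSpace ℝ (Fin n)) p).source)
    (v : TangentSpace (𝓡 n) y) : chartLift p y (chartDeriv p y v) = v :=
  chartLift_mfderiv hy v

theorem chartDeriv_chartLift {p y : M} (hy : y ∈ (chartAt (EuclideanSpace ℝ (Fin n)) p).source)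
    (v : EuclideanSpace ℝ (Fin n)) : chartDeriv p y (chartLift p y v) = v :=
  mfderiv_chartLift hy v

theorem chartMetric_extChartAt (S : Spacetime n r M) {p y : M}
    (hy : y ∈ (chartAt (EuclideanSpace ℝ (Fin n)) p).source) (v w : EuclideanSpace ℝ (Fin n)) :
    S.chartMetric p (extChartAt (𝓡 n) p y) v w =
      S.g y (chartLift p y v) (chartLift p y w) := by
  have h : ∀ y', y' = y → S.g y' (chartLift p y' v) (chartLift p y' w) =
      S.g y (chartLift p y v) (chartLift p y w) := by
    rintro _ rfl; rfl
  exact h _ ((extChartAt (𝓡 n) p).left_inv (by rwa [extChartAt_source]))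

theorem chartMetric_chartDeriv (S : Spacetime n r M) {p y : M}
    (hy : y ∈ (chartAt (EuclideanSpace ℝ (Fin n)) p).source) (v w : TangentSpace (𝓡 n) y) :
    S.chartMetric p (extChartAt (𝓡 n) p y) (chartDeriv p y v) (chartDeriv p y w) = S.g y v w := by
  rw [chartMetric_extChartAt S hy, chartLift_chartDeriv hy, chartLift_chartDeriv hy]

/-- On the open subset `Ω` of the chart at `p`, the future cone is the side of the constant
timelike vector `T`. -/
structure IsCausalChart (S : Spacetime n r M) (p : M) (Ω : Set (EuclideanSpace ℝ (Fin n)))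
    (T : EuclideanSpace ℝ (Fin n)) : Prop where
  lorentz : IsLorentzChart Ω (S.chartMetric p) T
  subset : Ω ⊆ (extChartAt (𝓡 n) p).target
  contDiffOn : ContDiffOn ℝ ((r - 1 : ℕ∞) : ℕ∞ω) (S.chartMetric p) Ω
  causal_iff : ∀ y ∈ (chartAt (EuclideanSpace ℝ (Fin n)) p).source, extChartAt (𝓡 n) p y ∈ Ω →
    ∀ v : TangentSpace (𝓡 n) y, S.IsFutureCausal v ↔
      S.chartMetric p (extChartAt (𝓡 n) p y) (chartDeriv p y v) (chartDeriv p y v) ≤ 0 ∧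
      S.chartMetric p (extChartAt (𝓡 n) p y) (chartDeriv p y v) T < 0

theorem IsCausalChart.timelike_iff {S : Spacetime n r M} {p : M}
    {Ω : Set (EuclideanSpace ℝ (Fin n))} {T : EuclideanSpace ℝ (Fin n)}
    (h : S.IsCausalChart p Ω T) {y : M}
    (hy : y ∈ (chartAt (EuclideanSpace ℝ (Fin n)) p).source) (hyΩ : extChartAt (𝓡 n) p y ∈ Ω)
    (v : TangentSpace (𝓡 n) y) : S.IsFutureTimelike v ↔
      S.chartMetric p (extChartAt (𝓡 n) p y) (chartDeriv p y v) (chartDeriv p y v) < 0 ∧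
      S.chartMetric p (extChartAt (𝓡 n) p y) (chartDeriv p y v) T < 0 := by
  have h1 := h.causal_iff y hy hyΩ v
  rw [IsFutureCausal] at h1
  rw [IsFutureTimelike, h1, ← chartMetric_chartDeriv S hy]
  constructor
  · rintro ⟨⟨_, h2⟩, h3⟩; exact ⟨h3, h2⟩
  · rintro ⟨h3, h2⟩; exact ⟨⟨h3.le, h2⟩, h3⟩

/-- A timelike vector defining the future at p is extended with constant coordinates. By continuity
it stays timelike nearby and on the same side as the local causal field X. As X also lies in the
future cone at each nearby point, `lorentz_cone_eq` identifies that cone with the side of the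
constant vector. -/
theorem exists_isCausalChart (S : Spacetime n r M) (hr : 3 ≤ r)
    [IsManifold (𝓡 n) (r : ℕ∞ω) M] (p : M) :
    ∃ Ω T, extChartAt (𝓡 n) p p ∈ Ω ∧ S.IsCausalChart p Ω T := by
  have hr1 : (1 : ℕ∞) ≤ r := le_trans (by norm_num) hr
  have hr2 : (2 : ℕ∞ω) ≤ ((r - 1 : ℕ∞) : ℕ∞ω) := by
    have h : (2 : ℕ∞) ≤ r - 1 := by
      have h3 : (3 : ℕ∞) - 1 = 2 := by norm_cast
      exact h3 ▸ tsub_le_tsub_right hr 1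
    exact WithTop.coe_le_coe.2 h
  have hp : p ∈ (chartAt (EuclideanSpace ℝ (Fin n)) p).source := mem_chart_source _ p
  have hsmooth := S.contDiffOn_chartMetric hr1 p
  have hcont : ContinuousAt (S.chartMetric p) (extChartAt (𝓡 n) p p) :=
    hsmooth.continuousOn.continuousAt ((isOpen_extChartAt_target p).mem_nhds
      (mem_extChartAt_target p))
  obtain ⟨T₀, hT₀, hfut⟩ := S.future_isCone p
  obtain ⟨U, hUo, hpU, X, hX, hXfut⟩ := S.future_smooth p
  set e := trivializationAt (EuclideanSpace ℝ (Fin n)) (TangentSpace (𝓡 n) (M := M)) p with he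
  set T : EuclideanSpace ℝ (Fin n) := chartDeriv p p T₀ with hT
  have hXc : ContinuousAt (fun y => chartDeriv p y (X y)) p := by
    have h1 := (hX.contMDiffAt (hUo.mem_nhds hpU))
    rw [Bundle.contMDiffAt_totalSpace] at h1
    refine h1.2.continuousAt.congr ?_
    filter_upwards [(chartAt (EuclideanSpace ℝ (Fin n)) p).open_source.mem_nhds hp] with y hy
    rw [chartDeriv, ← TangentBundle.continuousLinearMapAt_trivializationAt hy,
      Bundle.Trivialization.continuousLinearMapAt_apply,
      Bundle.Trivialization.coe_linearMapAt_of_mem _ (by simpa using hy)]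
  have hmc : ContinuousAt (fun y => S.chartMetric p (extChartAt (𝓡 n) p y)) p :=
    ContinuousAt.comp (f := extChartAt (𝓡 n) p) hcont (continuousAt_extChartAt p)
  have hgood : ∀ᶠ y in 𝓝 p, S.chartMetric p (extChartAt (𝓡 n) p y) T T < 0 ∧
      S.chartMetric p (extChartAt (𝓡 n) p y) (chartDeriv p y (X y)) T < 0 ∧ y ∈ U := by
    refine Filter.Eventually.and ?_ (Filter.Eventually.and ?_ (hUo.mem_nhds hpU))
    · refine ((hmc.clm_apply continuousAt_const).clm_apply continuousAt_const).eventually_lt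
        continuousAt_const ?_
      rwa [hT, chartMetric_chartDeriv S hp]
    · refine ((hmc.clm_apply hXc).clm_apply continuousAt_const).eventually_lt
        continuousAt_const ?_
      rw [hT, chartMetric_chartDeriv S hp]
      have := hXfut p hpU
      rw [hfut] at this
      exact this.2.2
  obtain ⟨N, hN, hNo, hpN⟩ := mem_nhds_iff.1 hgood
  set Ω := (extChartAt (𝓡 n) p).target ∩ (extChartAt (𝓡 n) p).symm ⁻¹' N with hΩ
  have hΩo : IsOpen Ω :=
    (continuousOn_extChartAt_symm p).isOpen_inter_preimage (isOpen_extChartAt_target p) hNo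
  have hback : ∀ x ∈ Ω, ∃ y ∈ (chartAt (EuclideanSpace ℝ (Fin n)) p).source,
      y ∈ N ∧ extChartAt (𝓡 n) p y = x := fun x hx =>
    ⟨_, by rw [← extChartAt_source (𝓡 n)]; exact (extChartAt (𝓡 n) p).map_target hx.1, hx.2,
      (extChartAt (𝓡 n) p).right_inv hx.1⟩
  have hspace : ∀ y ∈ (chartAt (EuclideanSpace ℝ (Fin n)) p).source,
      ∀ T' u : EuclideanSpace ℝ (Fin n), S.chartMetric p (extChartAt (𝓡 n) p y) T' T' < 0 →
      u ≠ 0 → S.chartMetric p (extChartAt (𝓡 n) p y) u T' = 0 →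
      0 < S.chartMetric p (extChartAt (𝓡 n) p y) u u := by
    intro y hy T' u hT' hu huT
    rw [chartMetric_extChartAt S hy] at hT' huT ⊢
    refine S.pos_of_orthogonal_timelike hT' (fun h0 => hu ?_) huT
    rw [← chartDeriv_chartLift hy u, h0, map_zero]
  have hsymm : ∀ y ∈ (chartAt (EuclideanSpace ℝ (Fin n)) p).source, ∀ v w,
      S.chartMetric p (extChartAt (𝓡 n) p y) v w = S.chartMetric p (extChartAt (𝓡 n) p y) w v := by
    intro y hy v w
    rw [chartMetric_extChartAt S hy, chartMetric_extChartAt S hy, S.symm]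
  refine ⟨Ω, T, ⟨mem_extChartAt_target p, ?_⟩, ⟨hΩo, (hsmooth.of_le hr2).mono inter_subset_left,
    ?_, ?_, ?_⟩, inter_subset_left, hsmooth.mono inter_subset_left, ?_⟩
  · rw [mem_preimage, extChartAt_to_inv]; exact hpN
  · intro x hx v w
    obtain ⟨y, hy, -, rfl⟩ := hback x hx
    exact hsymm y hy v w
  · intro x hx
    obtain ⟨y, hy, hyN, rfl⟩ := hback x hx
    exact (hN hyN).1
  · intro x hx u hu huT
    obtain ⟨y, hy, hyN, rfl⟩ := hback x hx
    exact hspace y hy T u (hN hyN).1 hu huT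
  · intro y hy hyΩ v
    have hyN : y ∈ N := by
      have := hyΩ.2
      rwa [mem_preimage, (extChartAt (𝓡 n) p).left_inv (by rwa [extChartAt_source])] at this
    obtain ⟨hTT, hXT, hyU⟩ := hN hyN
    obtain ⟨T₁, hT₁, hfut₁⟩ := S.future_isCone y
    have hXy := hXfut y hyU
    rw [hfut₁] at hXy
    rw [IsFutureCausal, hfut₁]
    have hcone : ∀ hv : v ≠ 0, S.g y v v ≤ 0 → (S.g y v T₁ < 0 ↔
        S.chartMetric p (extChartAt (𝓡 n) p y) (chartDeriv p y v) T < 0) := by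
      intro hv hvv
      rw [← chartMetric_chartDeriv S hy v T₁]
      refine lorentz_cone_eq (X := chartDeriv p y (X y)) (hsymm y hy) (hspace y hy _ · ?_)
        hTT ?_ ?_ hXT ?_ ?_
      · rwa [chartMetric_chartDeriv S hy]
      · rw [chartMetric_chartDeriv S hy]; exact hXy.2.1
      · rw [chartMetric_chartDeriv S hy]; exact hXy.2.2
      · intro h0
        apply hv
        rw [← chartLift_chartDeriv hy v, h0, map_zero]
      · rwa [chartMetric_chartDeriv S hy]
    rw [chartMetric_chartDeriv S hy]
    constructor
    · rintro ⟨hv, hvv, hvT⟩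
      exact ⟨hvv, (hcone hv hvv).1 hvT⟩
    · rintro ⟨hvv, hvT⟩
      have hv : v ≠ 0 := by
        rintro rfl
        simp at hvT
      exact ⟨hv, hvv, (hcone hv hvv).2 hvT⟩

end Spacetime

/-! ### Smooth pieces, concatenation and time reversal. -/

namespace Spacetime

variable {n : ℕ} {r : ℕ∞} {M : Type*} [TopologicalSpace M]
  [ChartedSpace (EuclideanSpace ℝ (Fin n)) M]

/-- `γ` is `C^r` on `[a, b]` and its velocity has the property `P` at every point. -/
def IsSmoothPiece (r : ℕ∞) (P : ∀ x : M, TangentSpace (𝓡 n) x → Prop) (γ : ℝ → M) (a b : ℝ) :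
    Prop :=
  ContMDiffOn 𝓘(ℝ, ℝ) (𝓡 n) (r : ℕ∞ω) γ (Icc a b) ∧
    ∀ s ∈ Icc a b, P (γ s) (mfderivWithin 𝓘(ℝ, ℝ) (𝓡 n) γ (Icc a b) s (1 : ℝ))

namespace IsSmoothPiece

variable {P Q : ∀ x : M, TangentSpace (𝓡 n) x → Prop} {γ γ' : ℝ → M} {a b : ℝ}

theorem congr (h : IsSmoothPiece r P γ a b) (heq : EqOn γ' γ (Icc a b)) :
    IsSmoothPiece r P γ' a b := by
  refine ⟨h.1.congr heq, fun s hs => ?_⟩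
  -- The two velocities live in tangent spaces at propositionally equal points; both are the model
  -- space, so the property is transported along the equality of points.
  have key : ∀ (x y : M) (_ : x = y) (v : EuclideanSpace ℝ (Fin n)), P y v → P x v := by
    rintro x _ rfl v hv; exact hv
  have := key _ _ (heq hs) _ (h.2 s hs)
  have e : mfderivWithin 𝓘(ℝ, ℝ) (𝓡 n) γ' (Icc a b) s =
      mfderivWithin 𝓘(ℝ, ℝ) (𝓡 n) γ (Icc a b) s :=
    mfderivWithin_congr heq (heq hs)
  rw [e]
  exact this

theorem mdifferentiableWithinAt (h : IsSmoothPiece r P γ a b) (hr : 1 ≤ r) {s : ℝ}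
    (hs : s ∈ Icc a b) : MDifferentiableWithinAt 𝓘(ℝ, ℝ) (𝓡 n) γ (Icc a b) s :=
  (h.1 s hs).mdifferentiableWithinAt (by
    have : (r : ℕ∞ω) ≠ ((0 : ℕ∞) : ℕ∞ω) := fun h0 => by
      rw [WithTop.coe_inj.1 h0] at hr
      exact absurd hr (by norm_num)
    exact this)

theorem uniqueMDiffWithinAt {a b s : ℝ} (hab : a < b) (hs : s ∈ Icc a b) :
    UniqueMDiffWithinAt 𝓘(ℝ, ℝ) (Icc a b) s :=
  uniqueMDiffWithinAt_iff_uniqueDiffWithinAt.2 (uniqueDiffOn_Icc hab s hs)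

/-- Affine reparametrization. -/
theorem comp_affine (h : IsSmoothPiece r P γ a b) (hr : 1 ≤ r) {k l a' b' : ℝ} (hab' : a' < b')
    (hmaps : MapsTo (fun s => k * s + l) (Icc a' b') (Icc a b))
    (hPQ : ∀ x v, P x v → Q x (k • v)) :
    IsSmoothPiece r Q (fun s => γ (k * s + l)) a' b' := by
  have hf : ContMDiff 𝓘(ℝ, ℝ) 𝓘(ℝ, ℝ) (r : ℕ∞ω) (fun s : ℝ => k * s + l) :=
    ContDiff.contMDiff (by fun_prop)
  refine ⟨h.1.comp hf.contMDiffOn hmaps, fun s hs => ?_⟩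
  have h1 := (h.mdifferentiableWithinAt hr (hmaps hs)).hasMFDerivWithinAt
  have h2' : HasDerivWithinAt (fun s : ℝ => k * s + l) k (Icc a' b') s := by
    simpa using ((hasDerivWithinAt_id s (Icc a' b')).const_mul k).add_const l
  have h2 := h2'.hasFDerivWithinAt.hasMFDerivWithinAt
  have h3 := (HasMFDerivWithinAt.comp (u := Icc a b) (g := γ) s h1 h2 hmaps).mfderivWithin
    (uniqueMDiffWithinAt hab' hs)
  have h4 := hPQ _ _ (h.2 _ (hmaps hs))
  let F : ℝ →L[ℝ] EuclideanSpace ℝ (Fin n) :=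
    mfderivWithin 𝓘(ℝ, ℝ) (𝓡 n) γ (Icc a b) (k * s + l)
  have h5 : mfderivWithin 𝓘(ℝ, ℝ) (𝓡 n) (fun s => γ (k * s + l)) (Icc a' b') s (1 : ℝ) =
      k • F 1 := by
    have h6 := congrArg (fun F : ℝ →L[ℝ] EuclideanSpace ℝ (Fin n) => F 1) h3
    refine h6.trans ?_
    change F ((ContinuousLinearMap.toSpanSingleton ℝ k : ℝ →L[ℝ] ℝ) 1) = k • F 1
    rw [← map_smul]
    simp
  rw [h5]
  exact h4

theorem mono (h : IsSmoothPiece r P γ a b) (hr : 1 ≤ r) {u v : ℝ} (hau : a ≤ u) (huv : u < v)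
    (hvb : v ≤ b) : IsSmoothPiece r P γ u v := by
  have := h.comp_affine (Q := P) hr (k := 1) (l := 0) huv
    (fun s hs => by simpa using ⟨hau.trans hs.1, hs.2.trans hvb⟩) (fun x v hv => by simpa using hv)
  simpa using this

end IsSmoothPiece

variable [IsManifold (𝓡 n) 1 M]

/-- `q` is reached from `p` along a single `C^r` future-directed timelike piece. -/
def TimelikePiece (S : Spacetime n r M) (p q : M) : Prop :=
  ∃ (γ : ℝ → M) (a b : ℝ), a < b ∧ IsSmoothPiece r (fun _ v => S.IsFutureTimelike v) γ a b ∧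
    γ a = p ∧ γ b = q

/-- Chronology becomes the transitive closure of single smooth pieces, so that transitivity and
reversal need to be checked only on pieces, without handling partitions. -/
theorem transGen_timelikePiece_of_partition (S : Spacetime n r M) (hr : 1 ≤ r) {γ : ℝ → M}
    {t : ℕ → ℝ} (N : ℕ) (h : ∀ i < N, t i < t (i + 1) ∧
      IsSmoothPiece r (fun _ v => S.IsFutureTimelike v) γ (t i) (t (i + 1))) :
    ∀ u v, t 0 ≤ u → u < v → v ≤ t N → Relation.TransGen S.TimelikePiece (γ u) (γ v) := by
  induction N with
  | zero => intro u v h1 h2 h3; linarith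
  | succ N ih =>
    intro u v h1 h2 h3
    have ih' := ih fun i hi => h i (hi.trans (Nat.lt_succ_self N))
    obtain ⟨hN, hp⟩ := h N (Nat.lt_succ_self N)
    rcases le_or_gt v (t N) with hv | hv
    · exact ih' u v h1 h2 hv
    rcases le_or_gt (t N) u with hu | hu
    · exact .single ⟨γ, u, v, h2, hp.mono hr hu h2 h3, rfl, rfl⟩
    · exact .tail (ih' u (t N) h1 hu le_rfl)
        ⟨γ, t N, v, hv, hp.mono hr le_rfl hv h3, rfl, rfl⟩

theorem TimelikePiece.chron {S : Spacetime n r M} {p q : M} (h : S.TimelikePiece p q) :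
    S.Chron p q := by
  obtain ⟨γ, a, b, hab, hp, ha, hb⟩ := h
  refine ⟨γ, a, b, ⟨hab, 1, fun i => if i = 0 then a else b, by simp, by simp, fun i hi => ?_⟩,
    ha, hb⟩
  obtain rfl : i = 0 := by omega
  exact ⟨hab, hp⟩

theorem Chron.append {S : Spacetime n r M} (hr : 1 ≤ r) {p q s : M} (h : S.Chron p q)
    (h' : S.TimelikePiece q s) : S.Chron p s := by
  obtain ⟨γ, a, b, ⟨hab, N, t, ht0, htN, ht⟩, hγa, hγb⟩ := h
  obtain ⟨δ, c, d, hcd, hδ, hδc, hδd⟩ := h'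
  have hδ' : IsSmoothPiece r (fun _ v => S.IsFutureTimelike v) (fun s => δ (1 * s + (c - b)))
      b (b + (d - c)) :=
    hδ.comp_affine hr (by linarith) (fun s hs => ⟨by linarith [hs.1], by linarith [hs.2]⟩)
      (fun x v hv => by simpa using hv)
  have hmono : ∀ i, i ≤ N → t i ≤ b := by
    intro i hi
    rw [← htN]
    refine Nat.decreasingInduction' (P := fun j => t j ≤ t N) (fun j hj _ hle =>
      (ht j hj).1.le.trans hle) hi le_rfl
  refine ⟨fun s => if s ≤ b then γ s else δ (1 * s + (c - b)), a, b + (d - c),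
    ⟨by linarith, N + 1, fun i => if i ≤ N then t i else b + (d - c), by simpa using ht0, by simp,
      fun i hi => ?_⟩, ?_, ?_⟩
  · rcases Nat.lt_succ_iff_lt_or_eq.1 hi with hi' | rfl
    · simp only [hi'.le, Nat.succ_le_of_lt hi', if_true]
      refine ⟨(ht i hi').1, ?_⟩
      refine IsSmoothPiece.congr (P := fun _ v => S.IsFutureTimelike v) (γ := γ) (ht i hi').2
        fun s hs => ?_
      exact if_pos (hs.2.trans (hmono _ (Nat.succ_le_of_lt hi')))
    · simp only [le_refl, if_true, Nat.not_succ_le_self, if_false, htN]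
      refine ⟨by linarith, ?_⟩
      refine IsSmoothPiece.congr (P := fun _ v => S.IsFutureTimelike v) hδ' fun s hs => ?_
      -- At the junction the first branch of the definition applies, and the value agrees with the
      -- start of δ.
      rcases hs.1.eq_or_lt with rfl | hlt
      · simp [hγb, hδc]
      · exact if_neg (not_le.2 hlt)
  · simp [hab.le, hγa]
  · have : ¬ (b + (d - c) ≤ b) := by linarith
    simp only [this, if_false]
    rw [← hδd]; congr 1; ring

theorem chron_iff_transGen (S : Spacetime n r M) (hr : 1 ≤ r) {p q : M} :
    S.Chron p q ↔ Relation.TransGen S.TimelikePiece p q := by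
  constructor
  · rintro ⟨γ, a, b, ⟨hab, N, t, ht0, htN, ht⟩, rfl, rfl⟩
    exact S.transGen_timelikePiece_of_partition hr N ht a b ht0.le hab htN.ge
  · intro h
    induction h with
    | single h => exact h.chron
    | tail _ h ih => exact ih.append hr h

theorem Chron.trans {S : Spacetime n r M} (hr : 1 ≤ r) {p q s : M} (h : S.Chron p q)
    (h' : S.Chron q s) : S.Chron p s := by
  rw [chron_iff_transGen S hr] at *
  exact h.trans h'

theorem IsFutureTimelikeCurve.chron {S : Spacetime n r M} (hr : 1 ≤ r) {γ : ℝ → M} {a b : ℝ}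
    (h : S.IsFutureTimelikeCurve γ a b) {u v : ℝ} (hau : a ≤ u) (huv : u < v) (hvb : v ≤ b) :
    S.Chron (γ u) (γ v) := by
  obtain ⟨hab, N, t, ht0, htN, ht⟩ := h
  rw [chron_iff_transGen S hr]
  exact S.transGen_timelikePiece_of_partition hr N ht u v (ht0.le.trans hau) huv (hvb.trans htN.ge)

/-- The spacetime with the opposite time-orientation. -/
def reverse (S : Spacetime n r M) : Spacetime n r M where
  g := S.g
  symm := S.symm
  lorentzian := S.lorentzian
  contMDiff := S.contMDiff
  future x := {v | -v ∈ S.future x}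
  future_isCone x := by
    obtain ⟨T, hT, hf⟩ := S.future_isCone x
    refine ⟨-T, by simpa using hT, ?_⟩
    ext v
    simp [hf]
  future_smooth x := by
    obtain ⟨U, hU, hx, X, hX, hf⟩ := S.future_smooth x
    refine ⟨U, hU, hx, -X, hX.neg_section, fun y hy => ?_⟩
    simpa using hf y hy

theorem reverse_reverse (S : Spacetime n r M) : S.reverse.reverse = S := by
  cases S
  simp [reverse]

theorem isFutureCausal_reverse (S : Spacetime n r M) {x : M} (v : TangentSpace (𝓡 n) x) :
    S.reverse.IsFutureCausal v ↔ S.IsFutureCausal (-v) := Iff.rfl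

theorem isFutureTimelike_reverse (S : Spacetime n r M) {x : M} (v : TangentSpace (𝓡 n) x) :
    S.reverse.IsFutureTimelike v ↔ S.IsFutureTimelike (-v) := by
  simp [IsFutureTimelike, reverse]

theorem TimelikePiece.reverse {S : Spacetime n r M} (hr : 1 ≤ r) {p q : M}
    (h : S.TimelikePiece p q) : S.reverse.TimelikePiece q p := by
  obtain ⟨γ, a, b, hab, hp, rfl, rfl⟩ := h
  refine ⟨fun s => γ (-1 * s + 0), -b, -a, by linarith, hp.comp_affine hr (by linarith)
    (fun s hs => ⟨by linarith [hs.2], by linarith [hs.1]⟩) (fun x v hv => ?_), by simp, by simp⟩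
  rw [isFutureTimelike_reverse]
  simpa using hv

theorem chron_reverse (S : Spacetime n r M) (hr : 1 ≤ r) {p q : M} :
    S.reverse.Chron p q ↔ S.Chron q p := by
  have key : ∀ (S : Spacetime n r M) {p q : M}, S.Chron p q → S.reverse.Chron q p := by
    intro S p q h
    rw [chron_iff_transGen _ hr] at *
    exact Relation.transGen_swap.1 (Relation.TransGen.mono
      (fun _ _ (h : S.TimelikePiece _ _) => h.reverse hr) _ _ h)
  refine ⟨fun h => ?_, key S⟩
  simpa [reverse_reverse] using key S.reverse h

theorem IsFutureCausalCurve.reverse {S : Spacetime n r M} (hr : 1 ≤ r) {γ : ℝ → M} {a b : ℝ}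
    (h : S.IsFutureCausalCurve γ a b) :
    S.reverse.IsFutureCausalCurve (fun s => γ (-1 * s + 0)) (-b) (-a) := by
  obtain ⟨hab, N, t, ht0, htN, ht⟩ := h
  refine ⟨by linarith, N, fun i => -t (N - i), by simp [htN], by simp [ht0], fun i hi => ?_⟩
  obtain ⟨hlt, hp⟩ := ht (N - (i + 1)) (by omega)
  have e : N - (i + 1) + 1 = N - i := by omega
  rw [e] at hlt hp
  refine ⟨by simpa using hlt, ?_⟩
  refine IsSmoothPiece.comp_affine (P := fun _ v => S.IsFutureCausal v)
    (Q := fun _ v => S.reverse.IsFutureCausal v) hp hr (neg_lt_neg hlt)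
    (fun s hs => ⟨by linarith [hs.2], by linarith [hs.1]⟩) (fun x v hv => ?_)
  rw [isFutureCausal_reverse]
  simpa using hv

end Spacetime

/-! ### Curves and geodesics in charts. -/

namespace Spacetime

variable {n : ℕ} {r : ℕ∞} {M : Type*} [TopologicalSpace M]
  [ChartedSpace (EuclideanSpace ℝ (Fin n)) M]

namespace IsSmoothPiece

variable {P : ∀ x : M, TangentSpace (𝓡 n) x → Prop} {γ : ℝ → M} {a b : ℝ}

/-- A curve subdivided into smooth pieces is continuous and has a smooth piece to the right of every
parameter. -/
theorem exists_right_of_partition (hr : 1 ≤ r) {t : ℕ → ℝ} (N : ℕ)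
    (h : ∀ i < N, t i < t (i + 1) ∧ IsSmoothPiece r P γ (t i) (t (i + 1))) :
    t 0 ≤ t N ∧ ContinuousOn γ (Icc (t 0) (t N)) ∧
      ∀ s ∈ Ico (t 0) (t N), ∃ d, s < d ∧ d ≤ t N ∧ IsSmoothPiece r P γ s d := by
  induction N with
  | zero => simp
  | succ N ih =>
    obtain ⟨hle, hc, ih⟩ := ih fun i hi => h i (hi.trans (Nat.lt_succ_self N))
    obtain ⟨hN, hp⟩ := h N (Nat.lt_succ_self N)
    refine ⟨hle.trans hN.le, ?_, fun s hs => ?_⟩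
    · rw [← Icc_union_Icc_eq_Icc hle hN.le]
      exact hc.union_of_isClosed hp.1.continuousOn isClosed_Icc isClosed_Icc
    · rcases lt_or_ge s (t N) with hsN | hsN
      · obtain ⟨d, hsd, hd, hp'⟩ := ih s ⟨hs.1, hsN⟩
        exact ⟨d, hsd, hd.trans hN.le, hp'⟩
      · exact ⟨t (N + 1), hs.2, le_rfl, hp.mono hr hsN hs.2 le_rfl⟩

variable [IsManifold (𝓡 n) 1 M]

theorem hasDerivWithinAt_chart (h : IsSmoothPiece r P γ a b) (hr : 1 ≤ r) {p : M}
    {s : ℝ} (hs : s ∈ Icc a b) (hγ : γ s ∈ (chartAt (EuclideanSpace ℝ (Fin n)) p).source) :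
    HasDerivWithinAt (fun s => extChartAt (𝓡 n) p (γ s))
      (chartDeriv p (γ s) (mfderivWithin 𝓘(ℝ, ℝ) (𝓡 n) γ (Icc a b) s (1 : ℝ))) (Icc a b) s := by
  have h1 := (h.mdifferentiableWithinAt hr hs).hasMFDerivWithinAt
  have h2 := (mdifferentiableAt_extChartAt (I := 𝓡 n) hγ).hasMFDerivAt
  let L : ℝ →L[ℝ] EuclideanSpace ℝ (Fin n) :=
    (chartDeriv p (γ s)).comp (mfderivWithin 𝓘(ℝ, ℝ) (𝓡 n) γ (Icc a b) s)
  have h3 : HasFDerivWithinAt (fun s => extChartAt (𝓡 n) p (γ s)) L (Icc a b) s :=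
    hasMFDerivWithinAt_iff_hasFDerivWithinAt.1 (h2.comp_hasMFDerivWithinAt s h1)
  exact h3.hasDerivWithinAt

end IsSmoothPiece

variable [IsManifold (𝓡 n) 1 M] [IsManifold (𝓡 n) (r : ℕ∞ω) M]

/-- A `C^r` curve in the image of a chart is the image of a `C^r` curve in the manifold. -/
theorem isSmoothPiece_of_chart {p : M} {c c' : ℝ → EuclideanSpace ℝ (Fin n)} {a b : ℝ}
    (hr : 1 ≤ r) (hab : a < b) {P : ∀ x : M, TangentSpace (𝓡 n) x → Prop}
    (hc : ContDiffOn ℝ (r : ℕ∞ω) c (Icc a b))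
    (hc' : ∀ s ∈ Icc a b, HasDerivWithinAt c (c' s) (Icc a b) s)
    (hmem : ∀ s ∈ Icc a b, c s ∈ (extChartAt (𝓡 n) p).target)
    (hP : ∀ s ∈ Icc a b, ∀ y ∈ (chartAt (EuclideanSpace ℝ (Fin n)) p).source,
      extChartAt (𝓡 n) p y = c s → ∀ v : TangentSpace (𝓡 n) y, chartDeriv p y v = c' s → P y v) :
    IsSmoothPiece r P (fun s => (extChartAt (𝓡 n) p).symm (c s)) a b := by
  have hC : ContMDiffOn 𝓘(ℝ, ℝ) (𝓡 n) (r : ℕ∞ω) (fun s => (extChartAt (𝓡 n) p).symm (c s))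
      (Icc a b) := (contMDiffOn_extChartAt_symm p).comp hc.contMDiffOn hmem
  have hT : IsSmoothPiece r (fun (x : M) (_ : TangentSpace (𝓡 n) x) => True)
    (fun s => (extChartAt (𝓡 n) p).symm (c s)) a b := ⟨hC, fun _ _ => trivial⟩
  have hsrc : ∀ s ∈ Icc a b, (extChartAt (𝓡 n) p).symm (c s) ∈
      (chartAt (EuclideanSpace ℝ (Fin n)) p).source := fun s hs => by
    rw [← extChartAt_source (𝓡 n)]; exact (extChartAt (𝓡 n) p).map_target (hmem s hs)
  refine ⟨hC, fun s hs => hP s hs _ (hsrc s hs) ((extChartAt (𝓡 n) p).right_inv (hmem s hs)) _ ?_⟩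
  have h1 := hT.hasDerivWithinAt_chart hr hs (hsrc s hs)
  have h2 := h1.congr (f₁ := c) (fun u hu => ((extChartAt (𝓡 n) p).right_inv (hmem u hu)).symm)
    ((extChartAt (𝓡 n) p).right_inv (hmem s hs)).symm
  exact ((uniqueDiffOn_Icc hab) s hs).eq_deriv _ h2 (hc' s hs)

/-- A geodesic of a causal chart with causal, respectively timelike, future initial momentum gives
a smooth causal, respectively timelike, curve. -/
theorem IsCausalChart.isSmoothPiece_geodesic {S : Spacetime n r M} (hr : 3 ≤ r) {p : M}
    {Ω : Set (EuclideanSpace ℝ (Fin n))} {T : EuclideanSpace ℝ (Fin n)}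
    (h : S.IsCausalChart p Ω T) {ε : ℝ} (hε : 0 < ε)
    {z : ℝ → EuclideanSpace ℝ (Fin n) × (EuclideanSpace ℝ (Fin n) →L[ℝ] ℝ)}
    (hz : IsGeodesic Ω (S.chartMetric p) ε z) (h0 : cometricSq (S.chartMetric p) (z 0) ≤ 0)
    (hT : (z 0).2 T < 0) (hne : ∀ t ∈ Icc 0 ε, (z t).2 ≠ 0) :
    IsSmoothPiece r (fun _ v => S.IsFutureCausal v)
        (fun s => (extChartAt (𝓡 n) p).symm (z s).1) 0 ε ∧
      (cometricSq (S.chartMetric p) (z 0) < 0 → IsSmoothPiece r (fun _ v => S.IsFutureTimelike v)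
        (fun s => (extChartAt (𝓡 n) p).symm (z s).1) 0 ε) := by
  have hr1 : (1 : ℕ∞) ≤ r := le_trans (by norm_num) hr
  have e1 : r - 2 + 1 = r - 1 := by
    induction r using ENat.recTopCoe with
    | top => rfl
    | coe r =>
      have : 3 ≤ r := by exact_mod_cast hr
      norm_cast
      omega
  have e2 : r - 2 + 1 + 1 = r := by
    rw [e1]; exact tsub_add_cancel_of_le hr1
  have hc : ContDiffOn ℝ (r : ℕ∞ω) (fun t => (z t).1) (Icc 0 ε) := by
    -- A C^(r-1) metric has a C^(r-2) geodesic field, and positions gain two derivatives: geodesics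
    -- are exactly C^r, as curves are required to be.
    have := hz.contDiffOn_fst h.lorentz hε (n := r - 2) (by
      have := h.contDiffOn
      rw [← e1] at this
      exact_mod_cast this)
    rw [← e2]
    exact_mod_cast this
  have hd := fun s (hs : s ∈ Icc 0 ε) => hz.hasDerivWithinAt_fst hs
  have hΩ := fun s (hs : s ∈ Icc 0 ε) => (hz s hs).2
  have hsq : ∀ s ∈ Icc 0 ε, S.chartMetric p (z s).1 (cometric (S.chartMetric p) (z s).1 (z s).2)
      (cometric (S.chartMetric p) (z s).1 (z s).2) = cometricSq (S.chartMetric p) (z 0) ∧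
      S.chartMetric p (z s).1 (cometric (S.chartMetric p) (z s).1 (z s).2) T < 0 := by
    intro s hs
    rw [h.lorentz.metric_cometric (hΩ s hs)]
    exact ⟨hz.cometricSq_eq h.lorentz hs, hz.apply_neg h.lorentz h0 hT hne hs⟩
  refine ⟨isSmoothPiece_of_chart hr1 hε hc hd (fun s hs => h.subset (hΩ s hs)) ?_, fun h0' =>
    isSmoothPiece_of_chart hr1 hε hc hd (fun s hs => h.subset (hΩ s hs)) ?_⟩
  · intro s hs y hy hys v hv
    rw [h.causal_iff y hy (hys ▸ hΩ s hs), hv, hys, (hsq s hs).1]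
    exact ⟨h0, (hsq s hs).2⟩
  · intro s hs y hy hys v hv
    rw [h.timelike_iff hy (hys ▸ hΩ s hs), hv, hys, (hsq s hs).1]
    exact ⟨h0', (hsq s hs).2⟩

end Spacetime

/-! ### The local chronology near a point. -/

namespace Spacetime

variable {n : ℕ} {r : ℕ∞} {M : Type*} [TopologicalSpace M]
  [ChartedSpace (EuclideanSpace ℝ (Fin n)) M]

/-- `γ` is continuous on `[a, b]` and to the right of every parameter it is `C^r` with velocities
in `P`. -/
def HasRightPieces (r : ℕ∞) (P : ∀ x : M, TangentSpace (𝓡 n) x → Prop) (γ : ℝ → M) (a b : ℝ) :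
    Prop :=
  ContinuousOn γ (Icc a b) ∧ ∀ s ∈ Ico a b, ∃ d, s < d ∧ d ≤ b ∧ IsSmoothPiece r P γ s d

namespace HasRightPieces

variable {P Q : ∀ x : M, TangentSpace (𝓡 n) x → Prop} {γ : ℝ → M} {a b : ℝ}

theorem mono (h : HasRightPieces r P γ a b) (hr : 1 ≤ r) {u v : ℝ} (hau : a ≤ u) (hvb : v ≤ b) :
    HasRightPieces r P γ u v := by
  refine ⟨h.1.mono (Icc_subset_Icc hau hvb), fun s hs => ?_⟩
  obtain ⟨d, hsd, -, hp⟩ := h.2 s ⟨hau.trans hs.1, hs.2.trans_le hvb⟩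
  exact ⟨min d v, lt_min hsd hs.2, min_le_right _ _,
    hp.mono hr le_rfl (lt_min hsd hs.2) (min_le_left _ _)⟩

theorem imp (h : HasRightPieces r P γ a b) (hPQ : ∀ x v, P x v → Q x v) :
    HasRightPieces r Q γ a b :=
  ⟨h.1, fun s hs => (h.2 s hs).imp fun _ hd =>
    ⟨hd.1, hd.2.1, hd.2.2.1, fun s hs => hPQ _ _ (hd.2.2.2 s hs)⟩⟩

variable [IsManifold (𝓡 n) 1 M]

theorem exists_hasDerivWithinAt (h : HasRightPieces r P γ a b) (hr : 1 ≤ r) {p : M} {s : ℝ}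
    (hs : s ∈ Ico a b) (hγ : γ s ∈ (chartAt (EuclideanSpace ℝ (Fin n)) p).source) :
    ∃ v, P (γ s) v ∧ HasDerivWithinAt (fun s => extChartAt (𝓡 n) p (γ s))
      (chartDeriv p (γ s) v) (Ici s) s := by
  obtain ⟨d, hsd, -, hp⟩ := h.2 s hs
  exact ⟨_, hp.2 s (left_mem_Icc.2 hsd.le), (hp.hasDerivWithinAt_chart hr (left_mem_Icc.2 hsd.le)
    hγ).mono_of_mem_nhdsWithin (Icc_mem_nhdsGE hsd)⟩

end HasRightPieces

variable [IsManifold (𝓡 n) 1 M]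

theorem IsFutureCausalCurve.hasRightPieces {S : Spacetime n r M} (hr : 1 ≤ r) {γ : ℝ → M}
    {a b : ℝ} (h : S.IsFutureCausalCurve γ a b) :
    HasRightPieces r (fun _ v => S.IsFutureCausal v) γ a b := by
  obtain ⟨hab, N, t, rfl, rfl, ht⟩ := h
  exact (IsSmoothPiece.exists_right_of_partition hr N ht).2

theorem IsFutureTimelikeCurve.hasRightPieces {S : Spacetime n r M} (hr : 1 ≤ r) {γ : ℝ → M}
    {a b : ℝ} (h : S.IsFutureTimelikeCurve γ a b) :
    HasRightPieces r (fun _ v => S.IsFutureTimelike v) γ a b := by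
  obtain ⟨hab, N, t, rfl, rfl, ht⟩ := h
  exact (IsSmoothPiece.exists_right_of_partition hr N ht).2

theorem IsSmoothPiece.isFutureCausalCurve {S : Spacetime n r M} {γ : ℝ → M} {a b : ℝ}
    (hab : a < b) (h : IsSmoothPiece r (fun _ v => S.IsFutureCausal v) γ a b) :
    S.IsFutureCausalCurve γ a b := by
  refine ⟨hab, 1, fun i => if i = 0 then a else b, by simp, by simp, fun i hi => ?_⟩
  obtain rfl : i = 0 := by omega
  exact ⟨hab, h⟩

/-- A relation `J` on the open set `N` with the properties of the relation of being joined by a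
timelike geodesic inside a convex neighbourhood. -/
structure IsLocalChronology (S : Spacetime n r M) (N : Set M) (J : M → M → Prop) : Prop where
  isOpen : IsOpen N
  chron : ∀ q ∈ N, ∀ y ∈ N, J q y → S.Chron q y
  isOpen_future : ∀ q ∈ N, IsOpen {y | y ∈ N ∧ J q y}
  of_timelike : ∀ (γ : ℝ → M) (a b : ℝ), a < b →
    HasRightPieces r (fun _ v => S.IsFutureTimelike v) γ a b → (∀ s ∈ Icc a b, γ s ∈ N) →
    J (γ a) (γ b)
  of_causal : ∀ q ∈ N, ∀ (γ : ℝ → M) (a b : ℝ), a ≤ b →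
    HasRightPieces r (fun _ v => S.IsFutureCausal v) γ a b → (∀ s ∈ Icc a b, γ s ∈ N) →
    J q (γ a) → J q (γ b)
  limit : ∀ (F : Filter M) [F.NeBot] (f : M → M) (x y : M), x ∈ N → y ∈ N → x ≠ y →
    Filter.Tendsto id F (𝓝 x) → Filter.Tendsto f F (𝓝 y) → (∀ᶠ q in F, J q (f q)) →
    ∃ (γ : ℝ → M) (a b : ℝ), S.IsFutureCausalCurve γ a b ∧ γ a = x ∧ γ b = y

variable [IsManifold (𝓡 n) (r : ℕ∞ω) M]

/-- The relation J q y says that the geodesic chosen from q to y has future timelike initial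
momentum. This condition is open in y, is preserved along causal curves by the Gauss lemma, and
degenerates in the limit only to a causal momentum. -/
theorem exists_isLocalChronology (S : Spacetime n r M) (hr : 3 ≤ r) (p : M) :
    ∃ (N : Set M) (J : M → M → Prop), p ∈ N ∧ S.IsLocalChronology N J := by
  have hr1 : (1 : ℕ∞) ≤ r := le_trans (by norm_num) hr
  obtain ⟨Ω, T, hpΩ, hΩ⟩ := S.exists_isCausalChart hr p
  obtain ⟨V, ε, z, hpV, hz⟩ := hΩ.lorentz.exists_geodesicFamily hpΩ
  set φ := extChartAt (𝓡 n) p with hφ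
  set G := S.chartMetric p with hG
  have hsrc : φ.source = (chartAt (EuclideanSpace ℝ (Fin n)) p).source := extChartAt_source _ _
  have hφc : ContinuousOn φ φ.source := continuousOn_extChartAt p
  have hcurve : ∀ q ∈ φ.source, φ q ∈ V → ∀ y ∈ φ.source, φ y ∈ V →
      cometricSq G (z (φ q) (φ y) 0) ≤ 0 → (z (φ q) (φ y) 0).2 T < 0 →
      ∃ γ : ℝ → M, γ 0 = q ∧ γ ε = y ∧ IsSmoothPiece r (fun _ v => S.IsFutureCausal v) γ 0 ε ∧
      (cometricSq G (z (φ q) (φ y) 0) < 0 →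
        IsSmoothPiece r (fun _ v => S.IsFutureTimelike v) γ 0 ε) := by
    intro q hq hqV y hy hyV h0 hT
    obtain ⟨hgeo, hini, hfin, hne, -⟩ := hz.joins _ hqV _ hyV
    have hne' := hne (fun h => by rw [h] at hT; simp at hT)
    obtain ⟨h1, h2⟩ := hΩ.isSmoothPiece_geodesic hr hz.pos hgeo h0 hT hne'
    refine ⟨_, ?_, ?_, h1, h2⟩
    · simp only [hini]; exact φ.left_inv hq
    · simp only [hfin]; exact φ.left_inv hy
  have hNo : IsOpen (φ.source ∩ φ ⁻¹' V) :=
    hφc.isOpen_inter_preimage (isOpen_extChartAt_source p) hz.isOpen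
  have hright : ∀ γ : ℝ → M, ∀ a b : ℝ, HasRightPieces r (fun _ v => S.IsFutureCausal v) γ a b →
      (∀ s ∈ Icc a b, γ s ∈ φ.source ∩ φ ⁻¹' V) → ContinuousOn (fun s => φ (γ s)) (Icc a b) ∧
      ∀ s ∈ Ico a b, ∃ v, HasDerivWithinAt (fun s => φ (γ s)) v (Ici s) s ∧
        G (φ (γ s)) v v ≤ 0 ∧ G (φ (γ s)) v T < 0 := by
    intro γ a b hγ hN
    refine ⟨hφc.comp hγ.1 fun s hs => (hN s hs).1, fun s hs => ?_⟩
    have hs' := hN s (Ico_subset_Icc_self hs)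
    obtain ⟨v, hv, hd⟩ := hγ.exists_hasDerivWithinAt hr1 hs (hsrc ▸ hs'.1)
    exact ⟨_, hd, (hΩ.causal_iff _ (hsrc ▸ hs'.1) (hz.mem_of_mem hs'.2) v).1 hv⟩
  refine ⟨φ.source ∩ φ ⁻¹' V, fun q y => IsTimelikeMomentum G T (z (φ q) (φ y) 0),
    ⟨mem_extChartAt_source p, hpV⟩, hNo, ?_, ?_, ?_, ?_, ?_⟩
  · rintro q ⟨hq, hqV⟩ y ⟨hy, hyV⟩ hJ
    obtain ⟨γ, h0, h1, -, h2⟩ := hcurve q hq hqV y hy hyV hJ.1.le hJ.2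
    exact TimelikePiece.chron ⟨γ, 0, ε, hz.pos, h2 hJ.1, h0, h1⟩
  · rintro q ⟨hq, hqV⟩
    have hc : ContinuousOn (fun y => (z (φ q) (φ y) 0).2) (φ.source ∩ φ ⁻¹' V) :=
      hz.continuousOn.comp (continuousOn_const.prodMk (hφc.mono inter_subset_left))
        fun y hy => ⟨hqV, hy.2⟩
    convert hc.isOpen_inter_preimage hNo (IsGeodesicFamily.isOpen_timelike G T (φ q)) using 1
    ext y
    exact and_congr_right fun hy => hz.isTimelikeMomentum_iff hqV hy.2
  · intro γ a b hab hγ hN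
    have ha := left_mem_Icc.2 hab.le
    obtain ⟨hc, hd⟩ := hright γ a b (hγ.imp fun _ _ h => h.1) hN
    refine hz.timelike_of_curve hΩ.lorentz (hN a ha).2 hc (fun t ht => (hN t ht).2) rfl hd ?_ b
      (right_mem_Ioc.2 hab)
    obtain ⟨v, hv, hd⟩ := hγ.exists_hasDerivWithinAt hr1 (left_mem_Ico.2 hab)
      (hsrc ▸ (hN a ha).1)
    exact ⟨_, hd, (hΩ.timelike_iff (hsrc ▸ (hN a ha).1) (hz.mem_of_mem (hN a ha).2) v).1 hv⟩
  · intro q hq γ a b hab hγ hN hJ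
    obtain ⟨hc, hd⟩ := hright γ a b hγ hN
    exact hz.timelike_of_causal_curve hΩ.lorentz hq.2 hc (fun t ht => (hN t ht).2) hd hJ b
      (right_mem_Icc.2 hab)
  · intro F _ f x y hx hy hxy hF hf hJ
    have hφx : Filter.Tendsto φ F (𝓝 (φ x)) :=
      ((hφc.continuousAt ((isOpen_extChartAt_source p).mem_nhds hx.1)).tendsto).comp hF
    have hφy : Filter.Tendsto (fun q => φ (f q)) F (𝓝 (φ y)) :=
      ((hφc.continuousAt ((isOpen_extChartAt_source p).mem_nhds hy.1)).tendsto).comp hf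
    have hξ : Filter.Tendsto (fun q => (z (φ q) (φ (f q)) 0).2) F (𝓝 (z (φ x) (φ y) 0).2) :=
      ((hz.continuousOn.continuousAt ((hz.isOpen.prod hz.isOpen).mem_nhds
        (show (φ x, φ y) ∈ V ×ˢ V from ⟨hx.2, hy.2⟩))).tendsto).comp (hφx.prodMk_nhds hφy)
    have hxΩ := hz.mem_of_mem hx.2
    have hA : Filter.Tendsto (fun q => cometric G (φ q)) F (𝓝 (cometric G (φ x))) :=
      ((hΩ.lorentz.contDiffAt_cometric hxΩ hΩ.lorentz.contDiffOn).continuousAt.tendsto).comp hφx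
    have hini := (hz.joins _ hx.2 _ hy.2).2.1
    have hev : Continuous fun w : (EuclideanSpace ℝ (Fin n) →L[ℝ] ℝ) × EuclideanSpace ℝ (Fin n) =>
        w.1 w.2 := continuous_fst.clm_apply continuous_snd
    have hev' : Continuous fun w : ((EuclideanSpace ℝ (Fin n) →L[ℝ] ℝ) →L[ℝ]
        EuclideanSpace ℝ (Fin n)) × (EuclideanSpace ℝ (Fin n) →L[ℝ] ℝ) => w.1 w.2 :=
      continuous_fst.clm_apply continuous_snd
    have hsq : cometricSq G (z (φ x) (φ y) 0) ≤ 0 := by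
      rw [cometricSq, hini]
      refine le_of_tendsto ((hev.tendsto (_, cometric G (φ x) _)).comp (hξ.prodMk_nhds
        ((hev'.tendsto (cometric G (φ x), _)).comp (hA.prodMk_nhds hξ)))) ?_
      filter_upwards [hJ, hF (hNo.mem_nhds hx), hf (hNo.mem_nhds hy)] with q hq hqN hfN
      have := hq.1
      rw [cometricSq, (hz.joins _ hqN.2 _ hfN.2).2.1] at this
      exact this.le
    have hT : (z (φ x) (φ y) 0).2 T ≤ 0 := by
      refine le_of_tendsto ((hev.tendsto (_, T)).comp (hξ.prodMk_nhds tendsto_const_nhds)) ?_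
      filter_upwards [hJ] with q hq using hq.2.le
    -- The limit momentum lies in the closed cone; it is nonzero because the endpoints differ, and a
    -- nonzero causal covector is strictly negative on `T` as soon as it is nonpositive.
    have hne : (z (φ x) (φ y) 0).2 ≠ 0 := fun h0 =>
      hxy (φ.injOn hx.1 hy.1 (hz.eq_of_zero _ hx.2 _ hy.2 h0))
    have hT' : (z (φ x) (φ y) 0).2 T ≠ 0 := by
      have e := hΩ.lorentz.metric_cometric hxΩ (z (φ x) (φ y) 0).2
      rw [← e]
      refine lorentz_ne_zero_of_causal (hΩ.lorentz.spacelike _ hxΩ) (fun h0 => ?_) ?_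
      · rw [h0, map_zero] at e
        exact hne e.symm
      · rw [e]
        rw [cometricSq, hini] at hsq
        exact hsq
    obtain ⟨γ, h0, h1, h2, -⟩ := hcurve x hx.1 hx.2 y hy.1 hy.2 hsq (lt_of_le_of_ne hT hT')
    exact ⟨γ, 0, ε, h2.isFutureCausalCurve hz.pos, h0, h1⟩

/-- The coordinate line through p in the constant direction `T` is future timelike near p, and its
points before p converge to p. -/
theorem mem_closure_chronPast (S : Spacetime n r M) (hr : 3 ≤ r) (p : M) :
    p ∈ closure (S.chronPast p) := by
  have hr1 : (1 : ℕ∞) ≤ r := le_trans (by norm_num) hr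
  obtain ⟨Ω, T, hpΩ, hΩ⟩ := S.exists_isCausalChart hr p
  set c : ℝ → EuclideanSpace ℝ (Fin n) := fun s => extChartAt (𝓡 n) p p + s • T with hc
  have hcc : ContDiff ℝ (r : ℕ∞ω) c := by fun_prop
  have hc0 : c 0 = extChartAt (𝓡 n) p p := by simp [hc]
  have hcd : ∀ s, HasDerivAt c T s := fun s => by
    simpa only [one_smul] using!
      ((hasDerivAt_id s).smul_const T).const_add (extChartAt (𝓡 n) p p)
  have hnear : ∀ᶠ s in 𝓝 (0 : ℝ), c s ∈ Ω :=
    hcc.continuous.continuousAt.eventually (by rw [hc0]; exact hΩ.lorentz.isOpen.mem_nhds hpΩ)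
  obtain ⟨δ, hδ, hball⟩ := Metric.eventually_nhds_iff.1 hnear
  have hmem : ∀ s ∈ Icc (-(δ / 2)) 0, c s ∈ Ω := fun s hs => hball (by
    rw [Real.dist_eq, sub_zero, abs_of_nonpos hs.2]; linarith [hs.1])
  have hp := isSmoothPiece_of_chart (M := M) (p := p) (P := fun _ v => S.IsFutureTimelike v) hr1
    (by linarith : -(δ / 2) < 0) hcc.contDiffOn (fun s _ => (hcd s).hasDerivWithinAt)
    (fun s hs => hΩ.subset (hmem s hs)) (fun s hs y hy hys v hv => by
      rw [hΩ.timelike_iff hy (hys ▸ hmem s hs), hv, hys]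
      exact ⟨hΩ.lorentz.timelike _ (hmem s hs), hΩ.lorentz.timelike _ (hmem s hs)⟩)
  set γ : ℝ → M := fun s => (extChartAt (𝓡 n) p).symm (c s) with hγ
  have hγ0 : γ 0 = p := by
    simp only [hγ, hc0]; exact extChartAt_to_inv p
  have hlim : Filter.Tendsto γ (𝓝[Ico (-(δ / 2)) 0] 0) (𝓝 p) := by
    have h1 := hp.1.continuousOn 0 (right_mem_Icc.2 (by linarith))
    rw [ContinuousWithinAt, hγ0] at h1
    exact h1.mono_left (nhdsWithin_mono _ Ico_subset_Icc_self)
  have : (𝓝[Ico (-(δ / 2)) 0] (0 : ℝ)).NeBot :=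
    right_nhdsWithin_Ico_neBot (by linarith)
  refine mem_closure_of_tendsto hlim ?_
  filter_upwards [self_mem_nhdsWithin] with s hs
  exact TimelikePiece.chron ⟨γ, s, 0, hs.2, hp.mono hr1 hs.1 hs.2 le_rfl, rfl, hγ0⟩

end Spacetime

/-! ### Global causality and volume functions. -/

theorem ContinuousOn.exists_Icc_subset_of_mem_nhds {X : Type*} [TopologicalSpace X] {γ : ℝ → X}
    {a b : ℝ} (hγ : ContinuousOn γ (Icc a b)) (hab : a < b) {N : Set X} (hN : N ∈ 𝓝 (γ b)) :
    ∃ u ∈ Ioo a b, ∀ s ∈ Icc u b, γ s ∈ N := by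
  have h1 := hγ b (right_mem_Icc.2 hab.le) hN
  rw [Filter.mem_map, nhdsWithin_Icc_eq_nhdsLE hab] at h1
  obtain ⟨u, hu, hsub⟩ := (mem_nhdsLE_iff_exists_Icc_subset).1 h1
  refine ⟨max u ((a + b) / 2), ⟨lt_max_of_lt_right (by linarith),
    max_lt hu (by linarith)⟩, fun s hs => hsub ⟨(le_max_left _ _).trans hs.1, hs.2⟩⟩

namespace Spacetime

variable {n : ℕ} {r : ℕ∞} {M : Type*} [TopologicalSpace M]
  [ChartedSpace (EuclideanSpace ℝ (Fin n)) M] [IsManifold (𝓡 n) 1 M]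

theorem chronPast_reverse (S : Spacetime n r M) (hr : 1 ≤ r) (p : M) :
    S.reverse.chronPast p = S.chronFuture p := ext fun _ => chron_reverse S hr

theorem chronFuture_reverse (S : Spacetime n r M) (hr : 1 ≤ r) (p : M) :
    S.reverse.chronFuture p = S.chronPast p := ext fun _ => chron_reverse S hr

theorem IsFutureCausal.ne_zero {S : Spacetime n r M} {x : M} {v : TangentSpace (𝓡 n) x}
    (hv : S.IsFutureCausal v) : v ≠ 0 := by
  obtain ⟨T, -, hf⟩ := S.future_isCone x
  rw [IsFutureCausal, hf] at hv
  exact hv.1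

theorem Chron.exists_between {S : Spacetime n r M} (hr : 1 ≤ r) {p q : M} (h : S.Chron p q) :
    ∃ x, S.Chron p x ∧ S.Chron x q := by
  obtain ⟨γ, a, b, hγ, rfl, rfl⟩ := h
  have hab := hγ.1
  exact ⟨γ ((a + b) / 2), hγ.chron hr le_rfl (by linarith) (by linarith),
    hγ.chron hr (by linarith) (by linarith) le_rfl⟩

theorem IsGeneralizedTimeFunction.reverse {S : Spacetime n r M} (hr : 1 ≤ r) {τ : M → ℝ}
    (h : S.IsGeneralizedTimeFunction τ) : S.reverse.IsGeneralizedTimeFunction (fun x => -τ x) := by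
  intro γ a b hγ u hu v hv huv
  have h1 := hγ.reverse hr
  rw [reverse_reverse] at h1
  have h2 := h _ _ _ h1
  have := h2 ⟨neg_le_neg hv.2, neg_le_neg hv.1⟩ ⟨neg_le_neg hu.2, neg_le_neg hu.1⟩
    (neg_lt_neg huv)
  simpa using this

/-- Reversal exchanges pasts and futures, and the sign in t⁺ compensates for traversing curves
backwards. -/
theorem isGeneralizedTimeFunction_tPlus_iff [MeasurableSpace M] (S : Spacetime n r M) (hr : 1 ≤ r)
    (m : Measure M) : S.IsGeneralizedTimeFunction (S.tPlus m) ↔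
      S.reverse.IsGeneralizedTimeFunction (S.reverse.tMinus m) := by
  have e : S.reverse.tMinus m = fun x => -S.tPlus m x := by
    funext x
    simp [tMinus, tPlus, chronPast_reverse S hr]
  rw [e]
  refine ⟨fun h => h.reverse hr, fun h => ?_⟩
  simpa [reverse_reverse] using h.reverse hr

variable [IsManifold (𝓡 n) (r : ℕ∞ω) M]

/-- The end of a timelike curve lies in a local neighbourhood of its endpoint; the local relation
from a point on that end is open and contains the endpoint. -/
theorem isOpen_chronFuture (S : Spacetime n r M) (hr : 3 ≤ r) (x : M) :
    IsOpen (S.chronFuture x) := by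
  have hr1 : (1 : ℕ∞) ≤ r := le_trans (by norm_num) hr
  rw [isOpen_iff_mem_nhds]
  rintro y ⟨γ, a, b, hγ, rfl, rfl⟩
  obtain ⟨N, J, hyN, hJ⟩ := S.exists_isLocalChronology hr (γ b)
  have hp := hγ.hasRightPieces hr1
  obtain ⟨u, hu, hN⟩ := hp.1.exists_Icc_subset_of_mem_nhds hγ.1 (hJ.isOpen.mem_nhds hyN)
  have huN := hN u (left_mem_Icc.2 hu.2.le)
  filter_upwards [(hJ.isOpen_future _ huN).mem_nhds ⟨hyN, hJ.of_timelike γ u b hu.2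
    (hp.mono hr1 hu.1.le le_rfl) hN⟩] with w hw
  exact (hγ.chron hr1 le_rfl hu.1 hu.2.le).trans hr1 (hJ.chron _ huN _ hw.1 hw.2)

theorem isOpen_chronPast (S : Spacetime n r M) (hr : 3 ≤ r) (x : M) :
    IsOpen (S.chronPast x) := by
  rw [← chronFuture_reverse S (le_trans (by norm_num) hr)]
  exact S.reverse.isOpen_chronFuture hr x

/-- The push-up property. -/
theorem Chron.trans_causal {S : Spacetime n r M} (hr : 3 ≤ r) {w : M} {γ : ℝ → M} {a b : ℝ}
    (hab : a ≤ b) (hγ : HasRightPieces r (fun _ v => S.IsFutureCausal v) γ a b)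
    (h : S.Chron w (γ a)) : S.Chron w (γ b) := by
  have hr1 : (1 : ℕ∞) ≤ r := le_trans (by norm_num) hr
  by_contra hb
  have hcl : IsClosed (Icc a b ∩ γ ⁻¹' (S.chronFuture w)ᶜ) :=
    hγ.1.preimage_isClosed_of_isClosed isClosed_Icc (S.isOpen_chronFuture hr w).isClosed_compl
  -- u is the first parameter not reached from w, which exists because I⁺(w) is open. Just before u
  -- the point is reached, and both the end of the timelike curve and the arc of γ up to u fit in
  -- one local neighbourhood, where `of_causal` extends the relation to u.
  obtain ⟨u, ⟨hu, hwu⟩, hleast⟩ := (isCompact_Icc.of_isClosed_subset hcl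
    inter_subset_left).exists_isLeast ⟨b, right_mem_Icc.2 hab, hb⟩
  have hau : a < u := lt_of_le_of_ne hu.1 fun h0 => hwu (h0 ▸ h)
  obtain ⟨N, J, huN, hJ⟩ := S.exists_isLocalChronology hr (γ u)
  obtain ⟨u₁, hu₁, hN⟩ := (hγ.1.mono (Icc_subset_Icc_right hu.2)).exists_Icc_subset_of_mem_nhds
    hau (hJ.isOpen.mem_nhds huN)
  have hw₁ : S.Chron w (γ u₁) := by
    by_contra hn
    exact absurd (hleast ⟨⟨hu₁.1.le, hu₁.2.le.trans hu.2⟩, hn⟩) (not_le.2 hu₁.2)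
  have hu₁N := hN u₁ (left_mem_Icc.2 hu₁.2.le)
  obtain ⟨β, c, d, hβ, rfl, hβd⟩ := hw₁
  have hβp := hβ.hasRightPieces hr1
  obtain ⟨u₂, hu₂, hN₂⟩ := hβp.1.exists_Icc_subset_of_mem_nhds hβ.1
    (hJ.isOpen.mem_nhds (hβd ▸ hu₁N))
  have hu₂N := hN₂ u₂ (left_mem_Icc.2 hu₂.2.le)
  have h1 := hJ.of_timelike β u₂ d hu₂.2 (hβp.mono hr1 hu₂.1.le le_rfl) hN₂
  rw [hβd] at h1
  have h2 := hJ.of_causal _ hu₂N γ u₁ u hu₁.2.le (hγ.mono hr1 hu₁.1.le hu.2) hN h1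
  exact hwu ((hβ.chron hr1 le_rfl hu₂.1 hu₂.2.le).trans hr1 (hJ.chron _ hu₂N _ huN h2))

theorem HasRightPieces.chronPast_subset {S : Spacetime n r M} (hr : 3 ≤ r) {γ : ℝ → M} {a b : ℝ}
    (hγ : HasRightPieces r (fun _ v => S.IsFutureCausal v) γ a b) {u v : ℝ} (hau : a ≤ u)
    (huv : u ≤ v) (hvb : v ≤ b) : S.chronPast (γ u) ⊆ S.chronPast (γ v) := fun _ hw =>
  Chron.trans_causal hr huv (hγ.mono (le_trans (by norm_num) hr) hau hvb) hw

/-- In a past distinguishing spacetime the chronological past strictly increases along causal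
curves. -/
theorem PastDistinguishing.chronPast_ssubset {S : Spacetime n r M} (hr : 3 ≤ r)
    (hS : S.PastDistinguishing) {γ : ℝ → M} {a b : ℝ}
    (hγ : HasRightPieces r (fun _ v => S.IsFutureCausal v) γ a b) (hab : a < b) :
    S.chronPast (γ a) ⊂ S.chronPast (γ b) := by
  have hr1 : (1 : ℕ∞) ≤ r := le_trans (by norm_num) hr
  refine (hγ.chronPast_subset hr le_rfl hab.le le_rfl).ssubset_of_ne fun heq => ?_
  -- All intermediate pasts are squeezed between two equal sets.
  have hconst : ∀ s ∈ Icc a b, γ s = γ a := fun s hs => hS _ _ <|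
    ((hγ.chronPast_subset hr hs.1 hs.2 le_rfl).trans heq.ge).antisymm
      (hγ.chronPast_subset hr le_rfl hs.1 hs.2)
  have hsrc := mem_chart_source (EuclideanSpace ℝ (Fin n)) (γ a)
  obtain ⟨v, hv, hd⟩ := hγ.exists_hasDerivWithinAt hr1 (left_mem_Ico.2 hab) hsrc
  have hd0 : HasDerivWithinAt (fun s => extChartAt (𝓡 n) (γ a) (γ s)) 0 (Ici a) a := by
    refine (hasDerivWithinAt_const a (Ici a) (extChartAt (𝓡 n) (γ a) (γ a))).congr_of_eventuallyEq
      ?_ rfl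
    filter_upwards [Icc_mem_nhdsGE hab] with s hs
    rw [hconst s hs]
  have h0 : chartDeriv (γ a) (γ a) v = 0 := (uniqueDiffWithinAt_Ici a).eq_deriv _ hd hd0
  refine hv.ne_zero ?_
  rw [← chartLift_chartDeriv hsrc v, h0, map_zero]

variable [MeasurableSpace M]

theorem PastDistinguishing.isGeneralizedTimeFunction [BorelSpace M] {S : Spacetime n r M} (hr : 3 ≤ r)
    (hS : S.PastDistinguishing) {m : Measure M} (hfin : m univ < ⊤)
    (hpos : ∀ U : Set M, IsOpen U → U.Nonempty → 0 < m U) :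
    S.IsGeneralizedTimeFunction (S.tMinus m) := by
  have hr1 : (1 : ℕ∞) ≤ r := le_trans (by norm_num) hr
  have : IsFiniteMeasure m := ⟨hfin⟩
  intro γ a b hγ u hu v hv huv
  obtain ⟨hsub, hne⟩ := hS.chronPast_ssubset hr ((hγ.hasRightPieces hr1).mono hr1 hu.1 hv.2) huv
  obtain ⟨z, hzv, hzu⟩ := not_subset.1 hne
  have hU : IsOpen (S.chronFuture z ∩ S.chronPast (γ v)) :=
    (S.isOpen_chronFuture hr z).inter (S.isOpen_chronPast hr (γ v))
  have hdisj : Disjoint (S.chronPast (γ u)) (S.chronFuture z ∩ S.chronPast (γ v)) :=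
    disjoint_left.2 fun w hw hw' => hzu (Chron.trans hr1 hw'.1 hw)
  have hmU := hpos _ hU (Chron.exists_between hr1 hzv)
  have hle : m (S.chronPast (γ u)) + m (S.chronFuture z ∩ S.chronPast (γ v)) ≤
      m (S.chronPast (γ v)) := by
    rw [← measure_union hdisj hU.measurableSet]
    exact measure_mono (union_subset hsub inter_subset_right)
  refine (ENNReal.toReal_lt_toReal (measure_ne_top _ _) (measure_ne_top _ _)).2 ?_
  exact (ENNReal.lt_add_right (measure_ne_top _ _) hmU.ne').trans_le hle

theorem IsGeneralizedTimeFunction.pastDistinguishing [T2Space M] {S : Spacetime n r M}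
    (hr : 3 ≤ r) {m : Measure M} (hfin : m univ < ⊤)
    (h : S.IsGeneralizedTimeFunction (S.tMinus m)) : S.PastDistinguishing := by
  have hr1 : (1 : ℕ∞) ≤ r := le_trans (by norm_num) hr
  have : IsFiniteMeasure m := ⟨hfin⟩
  have : LocallyCompactSpace M :=
    ChartedSpace.locallyCompactSpace (EuclideanSpace ℝ (Fin n)) M
  intro p q hpq
  by_contra hne
  obtain ⟨N, J, hpN, hJ⟩ := S.exists_isLocalChronology hr p
  obtain ⟨K, hKp, hKN, hK⟩ := local_compact_nhds
    (Filter.inter_mem (hJ.isOpen.mem_nhds hpN) (isOpen_ne.mem_nhds hne))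
  have hpK : p ∈ interior K := mem_interior_iff_mem_nhds.2 hKp
  have : (𝓝[S.chronPast p] p).NeBot :=
    mem_closure_iff_nhdsWithin_neBot.1 (S.mem_closure_chronPast hr p)
  -- An ultrafilter replaces the choice of convergent subsequences: on the compact set `K \ interior
  -- K` the exit points converge along it.
  set F := Ultrafilter.of (𝓝[S.chronPast p] p) with hF
  have hFle : (F : Filter M) ≤ 𝓝[S.chronPast p] p := Ultrafilter.of_le _
  have hFmem : ∀ᶠ x in (F : Filter M), x ∈ S.chronPast p ∩ interior K :=
    hFle (Filter.inter_mem self_mem_nhdsWithin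
      (mem_nhdsWithin_of_mem_nhds (isOpen_interior.mem_nhds hpK)))
  -- Since I⁻(p) = I⁻(q), a timelike curve runs from x to q outside K; its first point off the
  -- interior of K still lies in K, hence is not q, and the curve continues from there to q.
  have hexit : ∀ x ∈ S.chronPast p ∩ interior K, ∃ y ∈ K \ interior K, J x y ∧ S.Chron y q := by
    rintro x ⟨hx, hxK⟩
    rw [hpq] at hx
    obtain ⟨β, c, d, hβ, rfl, rfl⟩ := hx
    have hβp := hβ.hasRightPieces hr1
    have hcl : IsClosed (Icc c d ∩ β ⁻¹' (interior K)ᶜ) :=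
      hβp.1.preimage_isClosed_of_isClosed isClosed_Icc isOpen_interior.isClosed_compl
    obtain ⟨t, ⟨ht, htK⟩, hleast⟩ := (isCompact_Icc.of_isClosed_subset hcl
      inter_subset_left).exists_isLeast ⟨d, right_mem_Icc.2 hβ.1.le,
        fun hd => (hKN (interior_subset hd)).2 rfl⟩
    have hct : c < t := lt_of_le_of_ne ht.1 fun h0 => htK (h0 ▸ hxK)
    have hin : ∀ s ∈ Ico c t, β s ∈ interior K := fun s hs => by
      by_contra hn
      exact absurd (hleast ⟨⟨hs.1, hs.2.le.trans ht.2⟩, hn⟩) (not_le.2 hs.2)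
    have htK' : β t ∈ K := by
      have : (𝓝[Ico c t] t).NeBot := right_nhdsWithin_Ico_neBot hct
      refine hK.isClosed.mem_of_tendsto (b := 𝓝[Ico c t] t) ((hβp.1 t ht).mono_left
        (nhdsWithin_mono _ (Ico_subset_Icc_self.trans (Icc_subset_Icc_right ht.2)))) ?_
      filter_upwards [self_mem_nhdsWithin] with s hs using interior_subset (hin s hs)
    have htd : t < d := lt_of_le_of_ne ht.2 fun h0 => (hKN htK').2 (h0 ▸ rfl)
    refine ⟨β t, ⟨htK', htK⟩, hJ.of_timelike β c t hct (hβp.mono hr1 le_rfl ht.2) fun s hs => ?_,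
      hβ.chron hr1 hct.le htd le_rfl⟩
    rcases hs.2.lt_or_eq with hlt | rfl
    · exact (hKN (interior_subset (hin s ⟨hs.1, hlt⟩))).1
    · exact (hKN htK').1
  choose! f hfK hfJ hfq using hexit
  obtain ⟨y, hy, hfy⟩ := (hK.diff isOpen_interior).ultrafilter_le_nhds (F.map f) (by
    rw [Filter.le_principal_iff]
    exact hFmem.mono hfK)
  obtain ⟨γ, a, b, hγ, rfl, rfl⟩ := hJ.limit F f p y hpN (hKN hy.1).1 (fun h0 => hy.2 (h0 ▸ hpK))
    (hFle.trans nhdsWithin_le_nhds) hfy (hFmem.mono hfJ)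
  have hlt := h γ a b hγ (left_mem_Icc.2 hγ.1.le) (right_mem_Icc.2 hγ.1.le) hγ.1
  refine absurd hlt (not_lt.2 ?_)
  simp only [tMinus, hpq]
  -- If w precedes the limit y, openness of I⁺(w) puts some exit point in it, and that exit point
  -- precedes q.
  refine ENNReal.toReal_mono (measure_ne_top _ _) (measure_mono fun w hw => ?_)
  obtain ⟨x, hx, hwx⟩ := (hFmem.and (hfy ((S.isOpen_chronFuture hr w).mem_nhds hw))).exists
  exact Chron.trans hr1 hwx (hfq x hx)

end Spacetime

theorem mainTheorem9 {n : ℕ} (hn : 2 ≤ n) {r : ℕ∞} (hr : 3 ≤ r)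
    {M : Type*} [TopologicalSpace M] [ChartedSpace (EuclideanSpace ℝ (Fin n)) M]
    [IsManifold (𝓡 n) 1 M] [IsManifold (𝓡 n) (r : ℕ∞ω) M]
    [T2Space M] [ParacompactSpace M] [ConnectedSpace M]
    [MeasurableSpace M] [BorelSpace M]
    (S : Spacetime n r M) (m : Measure M) (hm : S.IsAdmissible m) :
    (S.PastDistinguishing ↔ S.IsGeneralizedTimeFunction (S.tMinus m)) ∧
    (S.FutureDistinguishing ↔ S.IsGeneralizedTimeFunction (S.tPlus m)) := by
  have key : ∀ S : Spacetime n r M,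
      S.PastDistinguishing ↔ S.IsGeneralizedTimeFunction (S.tMinus m) := fun S =>
    ⟨fun h => h.isGeneralizedTimeFunction hr hm.finite hm.pos_of_isOpen,
      fun h => h.pastDistinguishing hr hm.finite⟩
  have hr1 : (1 : ℕ∞) ≤ r := le_trans (by norm_num) hr
  refine ⟨key S, ?_⟩
  -- The future statement is the past one for the reversed time-orientation.
  rw [S.isGeneralizedTimeFunction_tPlus_iff hr1, ← key]
  simp only [Spacetime.FutureDistinguishing, Spacetime.PastDistinguishing, S.chronPast_reverse hr1]
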